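/- Let $G$ be a simple graph on $n$ vertices with maximum degree at most $\Delta_{\max}$, and let $c$ be a proper partial $(\Delta_{\max}+1)$-edge-colouring of $G$ (edges may be blank). Let $A(u)$ denote the set of colours on no edge at $u$ (available at $u$) and $N^2(\cdot)$ the set of vertices at distance at most $2$. For colours $\kappa\neq\kappa'$, a maximal $(\kappa,\kappa')$-bichromatic path is a component of the graph of the edges coloured $\kappa$ or $\kappa'$ that is a path, possibly a single vertex. Logarithms are to base $2$. Let $\ell, a$ be reals with $\ell\ge 10^4(10\Delta_{\max}+1)^{50\sqrt{\log n}}$ and $$\frac{\ell}{2^{3\sqrt{\log n}}(\Delta_{\max}+1)^{8\sqrt{\log n}}}\le a\le \frac{\ell}{2^{3\sqrt{\log n}}(\Delta_{\max}+1)^{6\sqrt{\log n}}}.$$ A stepping process $w_1+y_1+P_1+\dots+w_j+y_j+P_j$ from $w_1$ goes, in step $k$, from $w_k$ to a neighbour $y_k$ and then follows a path $P_k$ that begins at $y_k$ and is part of a maximal bichromatic path $Q_k$; for $k<j$ the path $P_k$ ends at $w_{k+1}$. It is represented by the string $P_1P_2\cdots P_j$, each path being one character. Consistent extension. Let $P_{k-1}=p_1\dots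 p_t$ ($t\ge2$) be an initial part of $Q_{k-1}=p_1\dots p_s$ with $s>t$, put $u=w_k=p_t$, $v=p_{t+1}$, $\kappa_1=c(p_{t-1}p_t)$, $\kappa_2=c(uv)$, and let $c'$ be $c$ with $uv$ made blank and $\kappa_1,\kappa_2$ interchanged on the edges of $P_{k-1}$. In $c'$, build a fan $v=x_1,x_2,\dots$ of neighbours of $u$ with colours $\alpha_1,\alpha_2,\dots$: at $x_h$, (1) if $A(x_h)\cap A(u)\ne\emptyset$, let $\alpha_h$ be its least element and stop; (2) otherwise, if $\alpha_g\in A(x_h)$ for some $g<h$, take the least such $g$, let $\alpha_h=\alpha_g$ and stop; (3) otherwise, if $A(x_h)\setminus\{\kappa_2\}\neq\emptyset$, let $\alpha_h$ be its least element and let $x_{h+1}$ be the neighbour of $u$ with $c'(ux_{h+1})=\alpha_h$; (4) otherwise let $\alpha_h=\kappa_2$ and stop. Let $x_m$ be the last vertex. If the fan stopped by (1), then $P_k=x_m$. If it stopped by (2), let $p$ be the maximal $(\tau,\alpha_m)$-bichromatic path of $c'$ beginning at $x_m$, with $\tau=\min A(u)\setminus\{\kappa_1,\kappa_2\}$. If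 it stopped by (4), let $p$ be the maximal $(\kappa_1,\kappa_2)$-bichromatic path of $c'$ beginning at $x_m$. In these two cases $P_k$ is either a truncation of $p$ (a proper initial part) or the full path, which is $p$; except that after (2), if $p$ ends in $x_gu$ with $g<m$, the full path is $p$ without $u$, followed from $x_g$ to $x_m$, and if $p$ ends in $x_g$ with $g<m$, the full path is $p$ followed from $x_g$ to $x_m$; in these two exceptional cases a truncation has at least $3$, respectively $2$, vertices fewer than $p$. The extension is augmenting if the fan stopped by (1) or $P_k$ is the full path. A stepping process is semi-consistent if every step $k\ge 2$ is a consistent extension of step $k-1$, and: $V(P_k)\cap V(P_h)=\emptyset$ whenever $|k-h|\ge2$; for $h\ne k$ the paths $P_h,P_k$ share no edge and $Q_h\ne Q_k$; $w_k$ and $P_k$ are disjoint from $N^2(w_h)$ for all $h<k$ and from $N^2(P_h)$ for all $h\le k-2$. It is augmenting if its last step is an augmenting extension or, for a one-step process, if $P_1=Q_1$. Then for every vertex $w$, every neighbour $y$ of $w$ and every maximal bichromatic path $P$ beginning at $y$, the vertex $w$ is $(a,\sqrt{\log n},\ell,\emptyset,\emptyset,P)$-heavy. That is, there is a non-empty set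 of augmenting, semi-consistent stepping processes from $w$, each with at most $\sqrt{\log n}$ steps, with all its paths having at most $\ell$ vertices, with $Q_1=P$ and with $P_1$ an initial part of $P$ beginning at $y$, such that in the trie of the strings representing them every node of depth at most $\sqrt{\log n}-1$ either has at least $a$ children or is a leaf of the compressed trie, in the sense that there is only one string below it and this string has at most one further character. -/

import Mathlib

namespace Stepping

variable {V K : Type*}

/-- `c` (with `none` for a blank edge) is a proper partial edge-colouring of `G`. Pairs that are
not edges carry no colour. -/
structure IsProperPartial (G : SimpleGraph V) (c : V → V → Option K) : Prop where
  symm : ∀ u v, c u v = c v u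
  adj : ∀ u v κ, c u v = some κ → G.Adj u v
  proper : ∀ u v w κ, c u v = some κ → c u w = some κ → v = w

/-- The colours available at `u`. -/
def avail (c : V → V → Option K) (u : V) : Set K := {κ | ∀ v, c u v ≠ some κ}

/-- `x` and `z` are consecutive (in either order) on the path listed by `P`. -/
def IsPathEdge (P : List V) (x z : V) : Prop := [x, z] <:+: P ∨ [z, x] <:+: P

/-- `Q` lists, from one end to the other, the vertices of a maximal `(a, b)`-bichromatic path:
a component of the graph of the edges coloured `a` or `b` that is a path (possibly with a single
vertex) and not a cycle. -/
structure IsMaxPath (c : V → V → Option K) (a b : K) (Q : List V) : Prop where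
  ne : a ≠ b
  nonempty : Q ≠ []
  nodup : Q.Nodup
  coloured : ∀ x z, [x, z] <:+: Q → c x z = some a ∨ c x z = some b
  maximal : ∀ x ∈ Q, ∀ z, (c x z = some a ∨ c x z = some b) → IsPathEdge Q x z

/-- The `2`-hop neighbourhood of a vertex. -/
def hop2 (G : SimpleGraph V) (x : V) : Set V := {z | G.edist x z ≤ 2}

/-- One step `w + y + P` of a stepping process: `start` is `w`, `path` lists `P` from `y` on, and
`host` is the maximal bichromatic path, with colours `col₁`, `col₂`, of which `P` is a part,
listed in the direction in which `P` is followed. -/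
structure Step (V K : Type*) where
  start : V
  path : List V
  host : List V
  col₁ : K
  col₂ : K

/-- A step jumps to a neighbour `y` and then follows a part of a maximal bichromatic path. -/
structure IsStep (G : SimpleGraph V) (c : V → V → Option K) (s : Step V K) : Prop where
  path_ne : s.path ≠ []
  adj : ∀ y ∈ s.path.head?, G.Adj s.start y
  host_max : IsMaxPath c s.col₁ s.col₂ s.host
  subpath : s.path <:+: s.host

open Classical in
/-- The colouring after shifting along `P`: the edge `uv` following `P` becomes blank, and the two
colours are interchanged on the edges of `P`. -/
noncomputable def shiftAlong (c : V → V → Option K) (P : List V) (u v : V) (κ₁ κ₂ : K) :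
    V → V → Option K := fun x z =>
  if (x = u ∧ z = v) ∨ (x = v ∧ z = u) then none
  else if IsPathEdge P x z then (c x z).map (Equiv.swap κ₁ κ₂)
  else c x z

section Fans

variable [LinearOrder K]

/-- `w 0, …, w k` is an initial part of the fan with centre `u` built on the blank edge `uv`, with
representative colours `α 0, …, α (k - 1)`. Before the last vertex, no available colour is also
available at `u`, no earlier representative is available, and the representative is the smallest
available colour other than `κ₂`; it is the colour of the next edge of the fan. -/
structure IsFan (c : V → V → Option K) (u v : V) (κ₂ : K) (k : ℕ) (w : ℕ → V) (α : ℕ → K) :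
    Prop where
  zero : w 0 = v
  disj : ∀ j < k, avail c (w j) ∩ avail c u = ∅
  fresh : ∀ j < k, ∀ h < j, α h ∉ avail c (w j)
  least : ∀ j < k, IsLeast (avail c (w j) \ {κ₂}) (α j)
  next : ∀ j < k, c u (w (j + 1)) = some (α j)

/-- First way to end the fan: a colour is available both at the last vertex and at the centre. -/
def EndsCommon (c : V → V → Option K) (u : V) (k : ℕ) (w : ℕ → V) (α : ℕ → K) : Prop :=
  IsLeast (avail c (w k) ∩ avail c u) (α k)

/-- Second way: otherwise, an earlier representative is available; the first one is used again. -/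
def EndsRepeat (c : V → V → Option K) (u : V) (k : ℕ) (w : ℕ → V) (α : ℕ → K) : Prop :=
  avail c (w k) ∩ avail c u = ∅ ∧
    ∃ h, IsLeast {h | h < k ∧ α h ∈ avail c (w k)} h ∧ α k = α h

/-- Third way: otherwise, only `κ₂` is left at the last vertex. -/
def EndsSecond (c : V → V → Option K) (u : V) (κ₂ : K) (k : ℕ) (w : ℕ → V) (α : ℕ → K) : Prop :=
  avail c (w k) ∩ avail c u = ∅ ∧ (∀ h < k, α h ∉ avail c (w k)) ∧
    avail c (w k) = {κ₂} ∧ α k = κ₂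

/-- The path `P` that is followed when the fan `w 0, …, w k` with centre `u` ended in a repeated
colour and `p` is the maximal bichromatic path that begins at `w k`. Either `P` is a truncation
of `p` (`full = false`), or the whole path is used (`full = true`); in the latter case one
starts from an earlier vertex `w s` of the fan if `p` comes back to the fan, and in this case
the last edge of `p` is left out if it is the edge from `w s` to `u`. -/
inductive Follows (u : V) (k : ℕ) (w : ℕ → V) (p P : List V) : Bool → Prop
  | truncCentre (q : List V) (s : ℕ) (hs : s < k) (hp : p = q ++ [w s, u]) (hP : P <+: p)
      (hlen : P.length + 2 < p.length) : Follows u k w p P false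
  | fullCentre (q : List V) (s : ℕ) (hs : s < k) (hp : p = q ++ [w s, u])
      (hP : P = (q ++ [w s]).reverse) : Follows u k w p P true
  | truncFan (s : ℕ) (hs : s < k) (hp : p.getLast? = some (w s)) (hP : P <+: p)
      (hlen : P.length + 1 < p.length) : Follows u k w p P false
  | fullFan (s : ℕ) (hs : s < k) (hp : p.getLast? = some (w s)) (hP : P = p.reverse) :
      Follows u k w p P true
  | truncAway (hu : p.getLast? ≠ some u) (hw : ∀ s < k, p.getLast? ≠ some (w s)) (hP : P <+: p)
      (hlen : P.length < p.length) : Follows u k w p P false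
  | fullAway (hu : p.getLast? ≠ some u) (hw : ∀ s < k, p.getLast? ≠ some (w s)) (hP : P = p) :
      Follows u k w p P true

/-- The step `t` is a consistent extension of the step `s`. The path of `s` is `l, x, u` and it
continues on its host with `v`. The colouring is shifted along it, the fan is built with centre
`u` on the blank edge `uv`, and the path of `t` is read off from the way in which the fan ends.
The last argument is `true` if the new path is followed to its end (the extension is augmenting)
and `false` if it is truncated. -/
inductive IsExtension (c : V → V → Option K) (s t : Step V K) : Bool → Prop
  | common (l r : List V) (x u v : V) (κ₁ κ₂ : K) (k : ℕ) (w : ℕ → V) (α : ℕ → K)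
      (hhost : s.host = l ++ x :: u :: v :: r) (hpath : s.path = l ++ [x, u])
      (h₁ : c x u = some κ₁) (h₂ : c u v = some κ₂) (hstart : t.start = u)
      (hfan : IsFan (shiftAlong c s.path u v κ₁ κ₂) u v κ₂ k w α)
      (hend : EndsCommon (shiftAlong c s.path u v κ₁ κ₂) u k w α)
      (hP : t.path = [w k]) : IsExtension c s t true
  | again (l r : List V) (x u v : V) (κ₁ κ₂ : K) (k : ℕ) (w : ℕ → V) (α : ℕ → K)
      (p : List V) (full : Bool)
      (hhost : s.host = l ++ x :: u :: v :: r) (hpath : s.path = l ++ [x, u])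
      (h₁ : c x u = some κ₁) (h₂ : c u v = some κ₂) (hstart : t.start = u)
      (hfan : IsFan (shiftAlong c s.path u v κ₁ κ₂) u v κ₂ k w α)
      (hend : EndsRepeat (shiftAlong c s.path u v κ₁ κ₂) u k w α)
      (hcol₁ : IsLeast (avail (shiftAlong c s.path u v κ₁ κ₂) u \ {κ₁, κ₂}) t.col₁)
      (hcol₂ : t.col₂ = α k)
      (hp : IsMaxPath (shiftAlong c s.path u v κ₁ κ₂) t.col₁ t.col₂ p)
      (hhead : p.head? = some (w k))
      (hP : Follows u k w p t.path full) : IsExtension c s t full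
  | second (l r : List V) (x u v : V) (κ₁ κ₂ : K) (k : ℕ) (w : ℕ → V) (α : ℕ → K)
      (p : List V) (full : Bool)
      (hhost : s.host = l ++ x :: u :: v :: r) (hpath : s.path = l ++ [x, u])
      (h₁ : c x u = some κ₁) (h₂ : c u v = some κ₂) (hstart : t.start = u)
      (hfan : IsFan (shiftAlong c s.path u v κ₁ κ₂) u v κ₂ k w α)
      (hend : EndsSecond (shiftAlong c s.path u v κ₁ κ₂) u κ₂ k w α)
      (hcol₁ : t.col₁ = κ₁) (hcol₂ : t.col₂ = κ₂)
      (hp : IsMaxPath (shiftAlong c s.path u v κ₁ κ₂) κ₁ κ₂ p)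
      (hhead : p.head? = some (w k))
      (hP : t.path <+: p) (hfull : full = true ↔ t.path = p) : IsExtension c s t full

end Fans

/-- `C` is a stepping process `w₁ + y₁ + P₁ + ⋯ + wᵢ + yᵢ + Pᵢ` with at least one step and with
`w₁ = w`. -/
structure IsProcess (G : SimpleGraph V) (c : V → V → Option K) (w : V) (C : List (Step V K)) :
    Prop where
  ne : C ≠ []
  steps : ∀ s ∈ C, IsStep G c s
  start : ∀ s ∈ C.head?, s.start = w
  link : ∀ (j : ℕ) (h : j + 1 < C.length), C[j].path.getLast? = some C[j + 1].start

/-- The non-overlapping condition on a stepping process. -/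
structure IsNonOverlapping (G : SimpleGraph V) (C : List (Step V K)) : Prop where
  vertices : ∀ (j k : ℕ) (_ : j < k) (hk : k < C.length),
    (∃ x, x ∈ C[j].path ∧ x ∈ C[k].path) → k ≤ j + 1
  edges : ∀ (j k : ℕ) (_ : j < k) (hk : k < C.length) (x z : V),
    ¬ (IsPathEdge C[j].path x z ∧ IsPathEdge C[k].path x z)
  centres : ∀ (j k : ℕ) (_ : j < k) (hk : k < C.length), ∀ x ∈ C[k].path, x ∉ hop2 G C[j].start
  hosts : ∀ (j k : ℕ) (_ : j < k) (hk : k < C.length),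
    C[j].host ≠ C[k].host ∧ C[j].host ≠ C[k].host.reverse

/-- Semi-consistent stepping processes that begin at `w`. -/
structure IsSemiConsistent [LinearOrder K] (G : SimpleGraph V) (c : V → V → Option K) (w : V)
    (C : List (Step V K)) : Prop where
  process : IsProcess G c w C
  nonOverlapping : IsNonOverlapping G C
  extension : ∀ (j : ℕ) (h : j + 1 < C.length), ∃ full, IsExtension c C[j] C[j + 1] full
  centre_centre : ∀ (j k : ℕ) (_ : k < j) (hj : j < C.length), C[j].start ∉ hop2 G C[k].start
  centre_path : ∀ (j k : ℕ) (_ : k + 1 < j) (hj : j < C.length),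
    ∀ x ∈ C[k].path, C[j].start ∉ hop2 G x
  path_centre : ∀ (j k : ℕ) (_ : k < j) (hj : j < C.length),
    ∀ z ∈ C[j].path, z ∉ hop2 G C[k].start
  path_path : ∀ (j k : ℕ) (_ : k + 1 < j) (hj : j < C.length),
    ∀ x ∈ C[k].path, ∀ z ∈ C[j].path, z ∉ hop2 G x

/-- A stepping process is augmenting if its last path is not truncated. -/
def IsAugmenting [LinearOrder K] (c : V → V → Option K) (C : List (Step V K)) : Prop :=
  (∃ s, C = [s] ∧ s.path = s.host) ∨ ∃ L s t, C = L ++ [s, t] ∧ IsExtension c s t true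

/-- The string `P₁ P₂ ⋯ Pᵢ` of a stepping process; each path is one character. -/
def str (C : List (Step V K)) : List (List V) := C.map Step.path

/-- The node `p` of the trie over `T` is a leaf of the compressed trie: there is just one string
of `T` below it, and this string is `p` or `p` and one more character. -/
def IsLeafNode {σ : Type*} (T : Set (List σ)) (p : List σ) : Prop :=
  ∃ s, {t ∈ T | p <+: t} = {s} ∧ s.length ≤ p.length + 1

/-- `(a, i)`-good sets of strings: every node of depth at most `i - 1` of the trie over `T` is a
leaf or has at least `a` children. -/
def IsGood {σ : Type*} (a i : ℝ) (T : Set (List σ)) : Prop :=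
  ∀ p : List σ, (∃ s ∈ T, p <+: s) → (p.length : ℝ) ≤ i - 1 →
    IsLeafNode T p ∨ ∃ F : Finset σ, a ≤ F.card ∧ ∀ x ∈ F, ∃ s ∈ T, p ++ [x] <+: s

/-- The process `C` satisfies the `(i, ℓ, A, B, P, y)`-restrictions, for graded vertex sets
`A`, `B` and the maximal `(a, b)`-bichromatic path `P` beginning at `y`. The steps are
numbered from `0`. -/
structure IsRestricted (i ℓ : ℝ) (A B : ℕ → Set V) (a b : K) (P : List V) (y : V)
    (C : List (Step V K)) : Prop where
  step_length : ∀ s ∈ C, (s.path.length : ℝ) ≤ ℓ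
  steps : (C.length : ℝ) ≤ i
  avoid_path : ∀ (k t : ℕ) (_ : k ≤ t) (ht : t < C.length), ∀ x ∈ C[t].path, x ∉ A k
  avoid_centre : ∀ (k t : ℕ) (_ : k ≤ t) (ht : t < C.length), C[t].start ∉ B k
  first_host : ∀ s ∈ C.head?, s.host = P ∧ s.col₁ = a ∧ s.col₂ = b
  first_path : ∀ s ∈ C.head?, s.path <+: P
  first_vertex : ∀ s ∈ C.head?, s.path.head? = some y

/-- `w` is `(d, i, ℓ, A, B, P)`-heavy, for the maximal `(a, b)`-bichromatic path `P` that begins at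
the neighbour `y` of `w`. -/
def IsHeavy [LinearOrder K] (G : SimpleGraph V) (c : V → V → Option K) (d i ℓ : ℝ)
    (A B : ℕ → Set V) (a b : K) (P : List V) (y w : V) : Prop :=
  ∃ S : Set (List (Step V K)), S.Nonempty ∧
    (∀ C ∈ S, IsSemiConsistent G c w C ∧ IsAugmenting c C ∧ IsRestricted i ℓ A B a b P y C) ∧
    IsGood d i (str '' S)

end Stepping

/-! If `P` has at most `ℓ` vertices, following it to its end is already an augmenting process.
Otherwise the choice of truncations is read as a game: a list of truncated steps wins within `m`
steps if one further step makes a good process of it, or if at least `a` truncations of the next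
path lead to lists that win within `m - 1` steps (`Wins`). A win from the empty list unfolds into
the required trie (`Wins.exists_good`).

Suppose that the empty list loses, and let `D` be the number of colours, `L = ⌊ℓ⌋` and `I = ⌊√(log
n)⌋`. At a losing list whose next path is long, at most `⌈a⌉` of the truncations to between `2` and
`L - 2` vertices win. Any other one whose last vertex is not next to an end of its host has a
continuation (`exists_isContinuation`); the path found in the shifted colouring is also maximal in
`c`, because the shift does not touch the two colours along it. The continuation is admissible
unless the new centre is next to an end of a host used so far, or lies in `spread`, the vertices
from which one comes too close to earlier steps (`IsPending.next`). If it is admissible and short,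
the truncation wins; so it is long, and the extended list is again a losing list with a long next
path. Such lists form a layered tree.

This tree is too large (`pow_le_of_layers`). The maximal path of two given colours through a vertex
has only two ends, so each vertex is reached from at most `M = 2 * D ^ 3` centres
(`card_origins_le`). Hence a vertex is the centre of at most `M ^ k` nodes of layer `k`, and the
layer has at most `n * M ^ k` nodes. On the other hand each layer is at least `R = ⌊L / 2⌋` times as
large as the one before, so `R ^ (I - 1) ≤ n * M ^ (I - 1)`, which fails for large `ℓ`.

The delicate point in the growth is that the bound on `spread` exceeds `L`, so that a single node
may lose all its children to it. The loss is bounded on average: `spread` at a node is contained in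
a set that depends only on the parent, and a vertex of this set together with one of its `M` origins
determines both the node among its siblings and the truncation. -/

namespace Stepping

variable {V K : Type*}

/-! ### Maximal bichromatic paths as lists -/

theorem IsPathEdge.symm {P : List V} {x z : V} (h : IsPathEdge P x z) : IsPathEdge P z x :=
  Or.symm h

theorem IsPathEdge.mono {P Q : List V} {x z : V} (h : IsPathEdge P x z) (hPQ : P <:+: Q) :
    IsPathEdge Q x z :=
  h.imp (fun h => h.trans hPQ) fun h => h.trans hPQ

theorem IsPathEdge.mem_left {P : List V} {x z : V} (h : IsPathEdge P x z) : x ∈ P := by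
  rcases h with h | h <;> exact h.subset (by simp)

theorem IsPathEdge.mem_right {P : List V} {x z : V} (h : IsPathEdge P x z) : z ∈ P :=
  h.symm.mem_left

theorem isPathEdge_reverse {P : List V} {x z : V} :
    IsPathEdge P.reverse x z ↔ IsPathEdge P x z := by
  have h : ∀ x z : V, [x, z] <:+: P.reverse ↔ [z, x] <:+: P := fun x z => by
    rw [← List.reverse_infix, List.reverse_reverse]; simp
  simp only [IsPathEdge, h, or_comm]

theorem head_of_isPathEdge {y z : V} {q : List V} (hq : (y :: q).Nodup)
    (h : IsPathEdge (y :: q) y z) : q.head? = some z := by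
  have hy : y ∉ q := (List.nodup_cons.1 hq).1
  rcases h with h | h <;> rcases List.infix_cons_iff.1 h with h | h
  · rw [List.cons_prefix_cons] at h
    obtain ⟨t, rfl⟩ := h.2
    simp
  · exact absurd (h.subset (by simp)) hy
  · rw [List.cons_prefix_cons] at h
    exact absurd (h.2.subset (by simp)) hy
  · exact absurd (h.subset (by simp)) hy

theorem exists_neighbours_of_mem {p : List V} {y : V} (hy : y ∈ p) (h₁ : p.head? ≠ some y)
    (h₂ : p.getLast? ≠ some y) : ∃ y₁ y₂, [y₁, y, y₂] <:+: p := by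
  obtain ⟨s, t, rfl⟩ := List.append_of_mem hy
  rcases s.eq_nil_or_concat' with rfl | ⟨s, y₁, rfl⟩
  · simp at h₁
  rcases t with _ | ⟨y₂, t⟩
  · simp at h₂
  exact ⟨y₁, y₂, s, t, by simp⟩

/-- The edge `xz` has one of the colours `a` and `b`. -/
def HasColour (c : V → V → Option K) (a b : K) (x z : V) : Prop := c x z = some a ∨ c x z = some b

theorem IsProperPartial.hasColour_symm {G : SimpleGraph V} {c : V → V → Option K}
    (hc : IsProperPartial G c) {a b : K} {x z : V} (h : HasColour c a b x z) :
    HasColour c a b z x := by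
  unfold HasColour at *; rwa [hc.symm z x]

theorem IsProperPartial.hasColour_ne {G : SimpleGraph V} {c : V → V → Option K}
    (hc : IsProperPartial G c) {a b : K} {x z : V} (h : HasColour c a b x z) : x ≠ z := by
  rcases h with h | h <;> exact (hc.adj _ _ _ h).ne

/-- A vertex has at most two neighbours along edges of two given colours. -/
theorem IsProperPartial.hasColour_cases {G : SimpleGraph V} {c : V → V → Option K}
    (hc : IsProperPartial G c) {a b : K} {x y z z' : V} (h₁ : HasColour c a b x y)
    (h₂ : HasColour c a b x z) (h : HasColour c a b x z') (hyz : y ≠ z) : z' = y ∨ z' = z := by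
  rcases h₁ with h₁ | h₁ <;> rcases h₂ with h₂ | h₂ <;> rcases h with h | h
  · exact absurd (hc.proper _ _ _ _ h₁ h₂) hyz
  · exact absurd (hc.proper _ _ _ _ h₁ h₂) hyz
  · exact .inl (hc.proper _ _ _ _ h h₁)
  · exact .inr (hc.proper _ _ _ _ h h₂)
  · exact .inr (hc.proper _ _ _ _ h h₂)
  · exact .inl (hc.proper _ _ _ _ h h₁)
  · exact absurd (hc.proper _ _ _ _ h₁ h₂) hyz
  · exact absurd (hc.proper _ _ _ _ h₁ h₂) hyz

theorem IsMaxPath.reverse {G : SimpleGraph V} {c : V → V → Option K} (hc : IsProperPartial G c)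
    {a b : K} {p : List V} (h : IsMaxPath c a b p) : IsMaxPath c a b p.reverse where
  ne := h.ne
  nonempty := by simpa using h.nonempty
  nodup := by simpa using h.nodup
  coloured x z hxz := hc.hasColour_symm <| h.coloured z x <| by
    rw [← List.reverse_infix]; simpa using hxz
  maximal x hx z hz := isPathEdge_reverse.2 (h.maximal x (by simpa using hx) z hz)

/-- Being a maximal path depends only on the edges of the two colours at the path. -/
theorem IsMaxPath.congr {c c' : V → V → Option K} {a b : K} {p : List V} (h : IsMaxPath c a b p)
    (hcc : ∀ x ∈ p, ∀ z, HasColour c' a b x z ↔ HasColour c a b x z) : IsMaxPath c' a b p where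
  ne := h.ne
  nonempty := h.nonempty
  nodup := h.nodup
  coloured x z hxz := (hcc x (hxz.subset (by simp)) z).2 (h.coloured x z hxz)
  maximal x hx z hz := h.maximal x hx z ((hcc x hx z).1 hz)

theorem IsMaxPath.hasColour {G : SimpleGraph V} {c : V → V → Option K} (hc : IsProperPartial G c)
    {a b : K} {p : List V} (h : IsMaxPath c a b p) {x z : V} (hxz : IsPathEdge p x z) :
    HasColour c a b x z := by
  rcases hxz with hxz | hxz
  · exact h.coloured _ _ hxz
  · exact hc.hasColour_symm (h.coloured _ _ hxz)

theorem IsMaxPath.swap {c : V → V → Option K} {a b : K} {p : List V} (h : IsMaxPath c a b p) :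
    IsMaxPath c b a p where
  ne := h.ne.symm
  nonempty := h.nonempty
  nodup := h.nodup
  coloured x z hxz := (h.coloured x z hxz).symm
  maximal x hx z hz := h.maximal x hx z hz.symm

/-- As `b` is missing at `x`, at most one edge of the two colours meets `x`, so its component is a
path with end `x`. If there were no such path, a list ending in `x` whose vertices other than the
head are saturated could be prolonged at its head for ever, against finiteness. -/
theorem exists_isMaxPath [Finite V] {G : SimpleGraph V} {c : V → V → Option K}
    (hc : IsProperPartial G c) {a b : K} (hab : a ≠ b) {x : V} (hx : b ∈ avail c x) :
    ∃ p, IsMaxPath c a b p ∧ p.head? = some x := by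
  classical
  have := Fintype.ofFinite V
  by_contra hcon
  have key : ∀ n : ℕ, ∃ p : List V, p.length = n + 1 ∧ p.Nodup ∧ p.getLast? = some x ∧
      (∀ y z, [y, z] <:+: p → HasColour c a b y z) ∧
      ∀ y ∈ p.tail, ∀ z, HasColour c a b y z → IsPathEdge p y z := by
    intro n
    induction n with
    | zero =>
      refine ⟨[x], by simp, by simp, by simp, fun y z h => ?_, by simp⟩
      have := h.length_le
      simp at this
    | succ n ih =>
      obtain ⟨p, hlen, hnd, hlast, hcol, hsat⟩ := ih
      obtain ⟨v, r, rfl⟩ : ∃ v r, p = v :: r := by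
        cases p with
        | nil => simp at hlen
        | cons v r => exact ⟨v, r, rfl⟩
      have hex : ∃ z, HasColour c a b v z ∧ ¬ IsPathEdge (v :: r) v z := by
        by_contra hno
        push Not at hno
        refine hcon ⟨(v :: r).reverse, IsMaxPath.reverse hc ⟨hab, by simp, hnd, hcol, ?_⟩,
          by rw [List.head?_reverse, hlast]⟩
        intro y hy z hz
        rcases List.mem_cons.1 hy with rfl | hy
        · exact hno z hz
        · exact hsat y hy z hz
      obtain ⟨z, hz, hnz⟩ := hex
      have hzr : z ∉ v :: r := by
        intro hmem
        rcases List.mem_cons.1 hmem with h | h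
        · exact hc.hasColour_ne hz h.symm
        · exact hnz (hsat z h v (hc.hasColour_symm hz)).symm
      have hinf : v :: r <:+: z :: v :: r := (List.suffix_cons z _).isInfix
      refine ⟨z :: v :: r, by simpa using hlen, List.nodup_cons.2 ⟨hzr, hnd⟩, by
        simpa using hlast, ?_, ?_⟩
      · intro y y' h
        rcases List.infix_cons_iff.1 h with h | h
        · rw [List.cons_prefix_cons, List.cons_prefix_cons] at h
          obtain ⟨rfl, rfl, -⟩ := h
          exact hc.hasColour_symm hz
        · exact hcol _ _ h
      · intro y hy y' hy'
        rcases List.mem_cons.1 hy with rfl | hy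
        · have hzy : IsPathEdge (z :: y :: r) y z := .inr ⟨[], r, by simp⟩
          -- The old head is now saturated: if it is `x`, only colour `a` can occur at it; otherwise
          -- its two neighbours on the list are all it can have.
          rcases r with _ | ⟨v', r⟩
          · obtain rfl : y = x := by simpa using hlast
            have h1 : c y z = some a := hz.resolve_right (hx z)
            have h2 : c y y' = some a := hy'.resolve_right (hx y')
            rwa [hc.proper _ _ _ _ h2 h1]
          · have hyv : IsPathEdge (y :: v' :: r) y v' := .inl ⟨[], r, by simp⟩
            have h1 : HasColour c a b y v' := hcol _ _ ⟨[], r, by simp⟩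
            rcases hc.hasColour_cases h1 hz hy' (fun h => hnz (h ▸ hyv)) with rfl | rfl
            · exact hyv.mono hinf
            · exact hzy
        · exact (hsat y hy y' hy').mono hinf
  obtain ⟨p, hlen, hnd, -⟩ := key (Fintype.card V)
  have := hnd.length_le_card
  omega

/-- A set that is closed under the edges of two colours contains every path of these colours that
it meets. -/
theorem forall_mem_of_closed {G : SimpleGraph V} {c : V → V → Option K}
    (hc : IsProperPartial G c) {a b : K} {S : Set V}
    (hS : ∀ x ∈ S, ∀ z, HasColour c a b x z → z ∈ S) {q : List V}
    (hq : ∀ x z, [x, z] <:+: q → HasColour c a b x z) {e : V} (he : e ∈ q) (heS : e ∈ S) :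
    ∀ z ∈ q, z ∈ S := by
  induction q generalizing e with
  | nil => simp
  | cons x q ih =>
    have ih' := @ih fun y z h => hq y z (h.trans (List.suffix_cons x q).isInfix)
    rcases q with _ | ⟨y, r⟩
    · obtain rfl : e = x := by simpa using he
      simpa using heS
    · have hxy : HasColour c a b x y := hq x y ⟨[], r, by simp⟩
      have hall : ∀ z ∈ y :: r, z ∈ S := by
        rcases List.mem_cons.1 he with rfl | he
        · exact ih' (List.mem_cons_self) (hS _ heS _ hxy)
        · exact ih' he heS
      intro z hz
      rcases List.mem_cons.1 hz with rfl | hz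
      · exact hS _ (hall y List.mem_cons_self) _ (hc.hasColour_symm hxy)
      · exact hall z hz

theorem IsMaxPath.closed {c : V → V → Option K} {a b : K} {p : List V} (h : IsMaxPath c a b p) :
    ∀ x ∈ {x | x ∈ p}, ∀ z, HasColour c a b x z → z ∈ {x | x ∈ p} :=
  fun x hx z hz => (h.maximal x hx z hz).mem_right

/-- A maximal path begins at an end of each maximal path of the same colours that it meets. -/
theorem IsMaxPath.head_eq_end {G : SimpleGraph V} {c : V → V → Option K}
    (hc : IsProperPartial G c) {a b : K} {p q : List V} (hp : IsMaxPath c a b p)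
    (hq : IsMaxPath c a b q) {e y : V} (hep : e ∈ p) (heq : e ∈ q) (hy : q.head? = some y) :
    p.head? = some y ∨ p.getLast? = some y := by
  by_contra! hcon
  have hyq : y ∈ q := List.mem_of_mem_head? hy
  have hyp : y ∈ p := forall_mem_of_closed hc hp.closed hq.coloured heq hep y hyq
  obtain ⟨y₁, y₂, h⟩ := exists_neighbours_of_mem hyp hcon.1 hcon.2
  have h1 : IsPathEdge p y y₁ := .inr (List.IsInfix.trans ⟨[], [y₂], by simp⟩ h)
  have h2 : IsPathEdge p y y₂ := .inl (List.IsInfix.trans ⟨[y₁], [], by simp⟩ h)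
  have h1' := hq.maximal y hyq _ (hp.hasColour hc h1)
  have h2' := hq.maximal y hyq _ (hp.hasColour hc h2)
  rcases q with _ | ⟨y', q⟩
  · simp at hy
  obtain rfl : y' = y := by simpa using hy
  -- The head of `q` has only one neighbour along `q`, so the two neighbours of `y` on `p` would
  -- coincide.
  have e := (head_of_isPathEdge hq.nodup h1').symm.trans (head_of_isPathEdge hq.nodup h2')
  have := h.sublist.nodup hp.nodup
  simp_all

end Stepping

/-! ### Free colours, fans and the shifted colouring -/

namespace Stepping

variable {V K : Type*}

/-- At an end of a blank edge fewer than `G.maxDegree` edges are coloured, so at least two colours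
are free there and one of them differs from `κ₀`. -/
theorem exists_mem_avail_ne [Fintype V] [Fintype K] {G : SimpleGraph V} [DecidableRel G.Adj]
    (hdeg : G.maxDegree < Fintype.card K) {c : V → V → Option K}
    (hc : ∀ x z κ, c x z = some κ → G.Adj x z) {u v : V} (huv : G.Adj u v) (hblank : c u v = none)
    (κ₀ : K) : ∃ κ ∈ avail c u, κ ≠ κ₀ := by
  classical
  by_contra! hcon
  have hsub : (Finset.univ.erase κ₀).image some ⊆
      ((G.neighborFinset u).erase v).image fun z => c u z := by
    intro o ho
    obtain ⟨κ, hκ, rfl⟩ := Finset.mem_image.1 ho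
    have : κ ∉ avail c u := fun h => (Finset.mem_erase.1 hκ).1 (hcon κ h)
    simp only [avail, Set.mem_ofPred_eq, not_forall, not_not] at this
    obtain ⟨z, hz⟩ := this
    refine Finset.mem_image.2 ⟨z, Finset.mem_erase.2 ⟨?_, ?_⟩, hz⟩
    · rintro rfl
      simp [hblank] at hz
    · simpa using hc _ _ _ hz
  have h1 := Finset.card_le_card hsub
  rw [Finset.card_image_of_injective _ (Option.some_injective K),
    Finset.card_erase_of_mem (Finset.mem_univ _), Finset.card_univ] at h1
  have h2 : (((G.neighborFinset u).erase v).image fun z => c u z).card ≤ _ :=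
    Finset.card_image_le
  rw [Finset.card_erase_of_mem (by simpa using huv), G.card_neighborFinset_eq_degree] at h2
  have h3 := G.degree_le_maxDegree u
  have h4 : 0 < G.degree u := (G.degree_pos_iff_exists_adj u).2 ⟨v, huv⟩
  omega

theorem avail_nonempty [Fintype V] [Fintype K] {G : SimpleGraph V} [DecidableRel G.Adj]
    (hdeg : G.maxDegree < Fintype.card K) {c : V → V → Option K}
    (hc : ∀ x z κ, c x z = some κ → G.Adj x z) (u : V) : (avail c u).Nonempty := by
  classical
  by_contra! hcon
  have hsub : (Finset.univ : Finset K).image some ⊆ (G.neighborFinset u).image fun z => c u z := by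
    intro o ho
    obtain ⟨κ, hκ, rfl⟩ := Finset.mem_image.1 ho
    have : κ ∉ avail c u := by simp [hcon]
    simp only [avail, Set.mem_ofPred_eq, not_forall, not_not] at this
    obtain ⟨z, hz⟩ := this
    exact Finset.mem_image.2 ⟨z, by simpa using hc _ _ _ hz, hz⟩
  have h1 := Finset.card_le_card hsub
  rw [Finset.card_image_of_injective _ (Option.some_injective K), Finset.card_univ] at h1
  have h2 : ((G.neighborFinset u).image fun z => c u z).card ≤ _ := Finset.card_image_le
  rw [G.card_neighborFinset_eq_degree] at h2
  have h3 := G.degree_le_maxDegree u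
  omega

theorem exists_isLeast [Finite K] [LinearOrder K] {S : Set K} (hS : S.Nonempty) :
    ∃ κ, IsLeast S κ := by
  obtain ⟨κ, hκ, h⟩ := Set.exists_min_image S id (Set.toFinite S) hS
  exact ⟨κ, hκ, fun x hx => h x hx⟩

theorem IsFan.congr [LinearOrder K] {c : V → V → Option K} {u v : V} {κ₂ : K} {k : ℕ}
    {w w' : ℕ → V} {α α' : ℕ → K} (h : IsFan c u v κ₂ k w α) (hw : ∀ j ≤ k, w' j = w j)
    (hα : ∀ j < k, α' j = α j) : IsFan c u v κ₂ k w' α' where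
  zero := by rw [hw 0 (Nat.zero_le _), h.zero]
  disj j hj := by rw [hw j hj.le]; exact h.disj j hj
  fresh j hj i hi := by rw [hw j hj.le, hα i (hi.trans hj)]; exact h.fresh j hj i hi
  least j hj := by rw [hw j hj.le, hα j hj]; exact h.least j hj
  next j hj := by rw [hw (j + 1) hj, hα j hj]; exact h.next j hj

/-- Each representative is available at its own fan vertex, where by `fresh` no earlier one is; so
the representatives are distinct. -/
theorem IsFan.length_le [LinearOrder K] [Fintype K] {c : V → V → Option K} {u v : V} {κ₂ : K}
    {k : ℕ} {w : ℕ → V} {α : ℕ → K} (h : IsFan c u v κ₂ k w α) : k ≤ Fintype.card K := by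
  have hlt : ∀ i j, i < j → j < k → α i ≠ α j := fun i j hij hj he =>
    h.fresh j hj i hij (he ▸ (h.least j hj).1.1)
  have hinj : Function.Injective fun i : Fin k => α i := by
    intro i j hij
    rcases lt_trichotomy i.1 j.1 with hlt' | heq | hgt
    · exact absurd hij (hlt _ _ hlt' j.2)
    · exact Fin.ext heq
    · exact absurd hij.symm (hlt _ _ hgt i.2)
  simpa using Fintype.card_le_of_injective _ hinj

/-- The fan construction ends. -/
theorem exists_isFan [LinearOrder K] [Fintype K] {c : V → V → Option K} (u v : V) (κ₂ : K)
    (hne : ∀ x, (avail c x).Nonempty) :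
    ∃ k w α, IsFan c u v κ₂ k w α ∧
      (EndsCommon c u k w α ∨ EndsRepeat c u k w α ∨ EndsSecond c u κ₂ k w α) := by
  by_contra! hcon
  have key : ∀ k, ∃ w α, IsFan c u v κ₂ k w α := by
    intro k
    induction k with
    | zero =>
      obtain ⟨κ, -⟩ := hne v
      exact ⟨fun _ => v, fun _ => κ, ⟨rfl, by simp, by simp, by simp, by simp⟩⟩
    | succ k ih =>
      obtain ⟨w, α, hf⟩ := ih
      -- A fan of length `k` says nothing about `α k`, so this value can be chosen to suit each of
      -- the three endings.
      have hup : ∀ κ, IsFan c u v κ₂ k w (Function.update α k κ) := fun κ =>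
        hf.congr (fun _ _ => rfl) fun j hj => Function.update_of_ne hj.ne _ _
      have hlt : ∀ κ, ∀ j < k, Function.update α k κ j = α j := fun κ j hj =>
        Function.update_of_ne hj.ne _ _
      have h1 : avail c (w k) ∩ avail c u = ∅ := by
        by_contra h
        obtain ⟨κ, hκ⟩ := exists_isLeast (Set.nonempty_iff_ne_empty.2 h)
        exact (hcon k w _ (hup κ)).1 (by simpa [EndsCommon] using hκ)
      have h2 : ∀ h < k, α h ∉ avail c (w k) := by
        by_contra! h
        classical
        let S : Set ℕ := {h | h < k ∧ α h ∈ avail c (w k)}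
        have hS : S.Nonempty := h
        have hleast : IsLeast S (sInf S) := ⟨Nat.sInf_mem hS, fun x hx => Nat.sInf_le hx⟩
        refine (hcon k w _ (hup (α (sInf S)))).2.1 ⟨h1, sInf S, ?_, ?_⟩
        · convert hleast using 1
          ext j
          refine and_congr_right fun hj => ?_
          rw [hlt _ j hj]
        · rw [hlt _ _ hleast.1.1, Function.update_self]
      have h3 : (avail c (w k) \ {κ₂}).Nonempty := by
        by_contra h
        rw [Set.not_nonempty_iff_eq_empty, Set.sdiff_eq_empty] at h
        refine (hcon k w _ (hup κ₂)).2.2 ⟨h1, fun j hj => ?_, ?_, Function.update_self _ _ _⟩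
        · rw [hlt _ j hj]
          exact h2 j hj
        · exact ((hne _).subset_singleton_iff).1 h
      obtain ⟨κ, hκ⟩ := exists_isLeast h3
      -- No colour is free at both `w k` and `u`, so `κ` occurs at `u`; its edge there leads to the
      -- next vertex of the fan.
      have h4 : κ ∉ avail c u := fun h =>
        (Set.mem_empty_iff_false κ).1 (h1 ▸ (⟨hκ.1.1, h⟩ : κ ∈ avail c (w k) ∩ avail c u))
      simp only [avail, Set.mem_ofPred_eq, not_forall, not_not] at h4
      obtain ⟨z, hz⟩ := h4
      have hw : ∀ j ≤ k, Function.update w (k + 1) z j = w j := fun j hj =>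
        Function.update_of_ne (by omega) _ _
      have hf' := (hup κ).congr hw fun _ _ => rfl
      refine ⟨Function.update w (k + 1) z, Function.update α k κ, hf'.zero, ?_, ?_, ?_, ?_⟩ <;>
        intro j hj <;> rcases Nat.lt_succ_iff_lt_or_eq.1 hj with hj | rfl
      · exact hf'.disj j hj
      · rw [hw _ le_rfl]; exact h1
      · exact hf'.fresh j hj
      · intro h hh
        rw [hw _ le_rfl, hlt _ _ hh]; exact h2 h hh
      · exact hf'.least j hj
      · rw [hw _ le_rfl, Function.update_self]; exact hκ
      · exact hf'.next j hj
      · simpa using hz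
  obtain ⟨w, α, h⟩ := key (Fintype.card K + 1)
  have := h.length_le
  omega

section Shift

variable {G : SimpleGraph V} {c : V → V → Option K} {P : List V} {u v x : V} {κ₁ κ₂ : K}

theorem shiftAlong_blank : shiftAlong c P u v κ₁ κ₂ u v = none := by simp [shiftAlong]

theorem adj_of_shiftAlong (hc : IsProperPartial G c) {y z : V} {κ : K}
    (h : shiftAlong c P u v κ₁ κ₂ y z = some κ) : G.Adj y z := by
  unfold shiftAlong at h
  split_ifs at h with h1 h2
  · obtain ⟨κ', h', -⟩ := Option.map_eq_some_iff.1 h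
    exact hc.adj _ _ _ h'
  · exact hc.adj _ _ _ h

theorem shiftAlong_of_notMem {y : V} (hyu : y ≠ u) (hyv : y ≠ v) (hy : y ∉ P) (z : V) :
    shiftAlong c P u v κ₁ κ₂ y z = c y z := by
  have : ¬ IsPathEdge P y z := fun h => hy h.mem_left
  simp [shiftAlong, hyu, hyv, this]

-- The shift only permutes `κ₁` and `κ₂` and erases an edge of colour `κ₂`. Hence bichromatic paths
-- in two other colours are the same before and after it.
open Classical in
theorem shiftAlong_eq_some_iff (hc : IsProperPartial G c) (huv : c u v = some κ₂) {τ : K}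
    (h₁ : τ ≠ κ₁) (h₂ : τ ≠ κ₂) {y z : V} :
    shiftAlong c P u v κ₁ κ₂ y z = some τ ↔ c y z = some τ := by
  unfold shiftAlong
  split_ifs with h h'
  · have : c y z = some κ₂ := by
      rcases h with ⟨rfl, rfl⟩ | ⟨rfl, rfl⟩
      · exact huv
      · rw [hc.symm]; exact huv
    simp [this, h₂.symm]
  · rw [Option.map_eq_some_iff]
    constructor
    · rintro ⟨κ, hκ, h⟩
      rw [Equiv.swap_apply_eq_iff, Equiv.swap_apply_of_ne_of_ne h₁ h₂] at h
      rwa [h] at hκ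
    · exact fun h => ⟨τ, h, Equiv.swap_apply_of_ne_of_ne h₁ h₂⟩
  · rfl

open Classical in
theorem shiftAlong_of_isPathEdge {y z : V} (hyu : ¬ (y = u ∧ z = v)) (hyv : ¬ (y = v ∧ z = u))
    (h : IsPathEdge P y z) (hyz : c y z = some κ₁) :
    shiftAlong c P u v κ₁ κ₂ y z = some κ₂ := by
  simp [shiftAlong, hyu, hyv, h, hyz]

open Classical in
/-- After the shift, the last colour of the path is available at the centre, the next one is not. -/
theorem avail_shiftAlong_centre (hc : IsProperPartial G c) {l r : List V}
    (hnd : (l ++ x :: u :: v :: r).Nodup) (hxu : c x u = some κ₁) (huv : c u v = some κ₂) :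
    κ₁ ∈ avail (shiftAlong c (l ++ [x, u]) u v κ₁ κ₂) u ∧
      κ₂ ∉ avail (shiftAlong c (l ++ [x, u]) u v κ₁ κ₂) u := by
  have hxv : x ≠ v := by
    rintro rfl
    simp [List.nodup_append] at hnd
  have huv' : u ≠ v := (hc.adj _ _ _ huv).ne
  have hpe : IsPathEdge (l ++ [x, u]) u x := .inr ⟨l, [], by simp⟩
  constructor
  · intro z hz
    unfold shiftAlong at hz
    split_ifs at hz with h h'
    · obtain ⟨κ, hκ, hs⟩ := Option.map_eq_some_iff.1 hz
      rw [Equiv.swap_apply_eq_iff, Equiv.swap_apply_left] at hs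
      rw [hs] at hκ
      exact h (.inl ⟨rfl, hc.proper _ _ _ _ hκ huv⟩)
    · rw [hc.symm] at hxu
      rw [hc.proper _ _ _ _ hz hxu] at h'
      exact h' hpe
  · intro h
    refine h x ?_
    exact shiftAlong_of_isPathEdge (by simp [hxv]) (by simp [huv']) hpe (by rw [hc.symm, hxu])

/-- After the shift, the two colours of the host are still present at the vertices inside it,
except at the ends of the blank edge. -/
theorem notMem_avail_shiftAlong (hc : IsProperPartial G c) {l r : List V}
    (hQ : IsMaxPath c κ₁ κ₂ (l ++ x :: u :: v :: r)) {z : V} (hz : z ∈ l ++ x :: u :: v :: r)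
    (hzu : z ≠ u) (hzv : z ≠ v) (h₁ : (l ++ x :: u :: v :: r).head? ≠ some z)
    (h₂ : (l ++ x :: u :: v :: r).getLast? ≠ some z) :
    κ₂ ∉ avail (shiftAlong c (l ++ [x, u]) u v κ₁ κ₂) z := by
  have hnd := hQ.nodup
  have two : ∀ y y', [y, z, y'] <:+: l ++ x :: u :: v :: r → ∀ κ, (κ = κ₁ ∨ κ = κ₂) →
      c z y = some κ ∨ c z y' = some κ := by
    intro y y' h
    have e1 : HasColour c κ₁ κ₂ z y := hc.hasColour_symm <|
      hQ.coloured _ _ (List.IsInfix.trans ⟨[], [y'], by simp⟩ h)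
    have e2 : HasColour c κ₁ κ₂ z y' := hQ.coloured _ _ (List.IsInfix.trans ⟨[y], [], by simp⟩ h)
    have hne : y ≠ y' := by
      have := h.sublist.nodup hnd
      simp_all
    rintro κ (rfl | rfl) <;> rcases e1 with e1 | e1 <;> rcases e2 with e2 | e2 <;>
      first
      | exact absurd (hc.proper _ _ _ _ e1 e2) hne
      | exact .inl e1
      | exact .inr e2
  have hmem : z ∈ l ++ [x] ∨ z ∈ r := by simp at hz ⊢; tauto
  intro hav
  rcases hmem with hz' | hz'
  -- Before `u` both edges of the host at `z` lie on the shifted path, and the one of colour `κ₁`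
  -- receives `κ₂`.
  · obtain ⟨s, t, ht⟩ := List.append_of_mem hz'
    rcases s.eq_nil_or_concat' with rfl | ⟨s, y, rfl⟩
    · refine h₁ ?_
      have : l ++ x :: u :: v :: r = (l ++ [x]) ++ u :: v :: r := by simp
      rw [this, ht]; simp
    obtain ⟨y', t', ht'⟩ : ∃ y' t', t ++ [u] = y' :: t' := by
      cases t <;> simp
    have hP : l ++ [x, u] = s ++ [y, z, y'] ++ t' := by
      have : l ++ [x, u] = (l ++ [x]) ++ [u] := by simp
      rw [this, ht]; simp [ht']
    have hPi : [y, z, y'] <:+: l ++ [x, u] := ⟨s, t', hP.symm⟩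
    have hPQ : l ++ [x, u] <:+: l ++ x :: u :: v :: r := ⟨[], v :: r, by simp⟩
    have p1 : IsPathEdge (l ++ [x, u]) z y := .inr (List.IsInfix.trans ⟨[], [y'], by simp⟩ hPi)
    have p2 : IsPathEdge (l ++ [x, u]) z y' := .inl (List.IsInfix.trans ⟨[y], [], by simp⟩ hPi)
    rcases two _ _ (hPi.trans hPQ) κ₁ (.inl rfl) with e | e
    · exact hav y (shiftAlong_of_isPathEdge (by simp [hzu]) (by simp [hzv]) p1 e)
    · exact hav y' (shiftAlong_of_isPathEdge (by simp [hzu]) (by simp [hzv]) p2 e)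
  -- Beyond `v` nothing is recoloured, and the edge of colour `κ₂` at `z` survives.
  · have hzP : z ∉ l ++ [x, u] := by
      have : (l ++ [x, u] ++ v :: r).Nodup := by simpa using hnd
      exact fun h => (List.nodup_append.1 this).2.2 z h z (by simp [hz']) rfl
    obtain ⟨y, y', h⟩ := exists_neighbours_of_mem hz h₁ h₂
    rcases two y y' h κ₂ (.inr rfl) with e | e
    · exact hav y (by rw [shiftAlong_of_notMem hzu hzv hzP, e])
    · exact hav y' (by rw [shiftAlong_of_notMem hzu hzv hzP, e])

end Shift

end Stepping

/-! ### Continuations of a truncated step -/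

namespace Stepping

variable {V K : Type*}

/-- The step that follows the host of `q` on its first `t` vertices. -/
def Step.trunc (q : Step V K) (t : ℕ) : Step V K := { q with path := q.host.take t }

/-- `f` is an augmenting extension of `s`, and `q` describes the maximal path on which it is
found, listed from a neighbour of the centre on. Either `f` has a single vertex, or truncations of
`q` are consistent extensions of `s`. -/
structure IsContinuation [LinearOrder K] (G : SimpleGraph V) (c : V → V → Option K)
    (s q f : Step V K) : Prop where
  link : s.path.getLast? = some q.start
  host_max : IsMaxPath c q.col₁ q.col₂ q.host
  adj : ∀ y ∈ q.host.head?, G.Adj q.start y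
  full_start : f.start = q.start
  full_isStep : IsStep G c f
  full_host : f.host = q.host ∨ f.host = q.host.reverse
  full_subset : f.path ⊆ q.host
  full_length : f.path.length ≤ q.host.length
  full_extension : IsExtension c s f true
  full_edges : ∀ x z, IsPathEdge s.path x z → ¬ IsPathEdge f.path x z
  single_or : f.path.length = 1 ∨
    ((∀ t, 1 ≤ t → t + 2 < q.host.length → IsExtension c s (q.trunc t) false) ∧
      ∀ x z, IsPathEdge s.path x z → ¬ IsPathEdge q.host x z)

variable {G : SimpleGraph V} {c : V → V → Option K} {s : Step V K} {l r : List V} {x u v : V}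
  {κ₁ κ₂ : K} {k : ℕ} {w : ℕ → V} {α : ℕ → K}

theorem shiftAlong_blank' {P : List V} : shiftAlong c P u v κ₁ κ₂ v u = none := by
  simp [shiftAlong]

theorem IsFan.adj [LinearOrder K] (hc : IsProperPartial G c) {P : List V} (huv : c u v = some κ₂)
    (hfan : IsFan (shiftAlong c P u v κ₁ κ₂) u v κ₂ k w α) {j : ℕ} (hj : j ≤ k) :
    G.Adj u (w j) := by
  cases j with
  | zero => rw [hfan.zero]; exact hc.adj _ _ _ huv
  | succ j => exact adj_of_shiftAlong hc (hfan.next j hj)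

/-- The new path is the single vertex `w k`, so any maximal path of `c` that begins there can serve
as its host. One exists because some colour is free at `w k`. -/
theorem exists_isContinuation_common [LinearOrder K] [Fintype V] [Fintype K] [DecidableRel G.Adj]
    (hdeg : G.maxDegree < Fintype.card K) (hc : IsProperPartial G c)
    (hhost : s.host = l ++ x :: u :: v :: r) (hpath : s.path = l ++ [x, u])
    (h₁ : c x u = some κ₁) (h₂ : c u v = some κ₂)
    (hfan : IsFan (shiftAlong c s.path u v κ₁ κ₂) u v κ₂ k w α)
    (hend : EndsCommon (shiftAlong c s.path u v κ₁ κ₂) u k w α) :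
    ∃ q f, IsContinuation G c s q f := by
  obtain ⟨b, hb⟩ := avail_nonempty hdeg hc.adj (w k)
  obtain ⟨a, ha⟩ : ∃ a : K, a ≠ b := by
    have := G.degree_le_maxDegree u
    have h4 : 0 < G.degree u := (G.degree_pos_iff_exists_adj u).2 ⟨v, hc.adj _ _ _ h₂⟩
    have : Nontrivial K := Fintype.one_lt_card_iff_nontrivial.1 (by omega)
    exact exists_ne b
  obtain ⟨p, hp, hhead⟩ := exists_isMaxPath hc ha hb
  have hadj := hfan.adj hc h₂ le_rfl
  obtain ⟨p', rfl⟩ : ∃ p', p = w k :: p' := by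
    cases p with
    | nil => simp at hhead
    | cons y p' => exact ⟨p', by simpa using hhead⟩
  refine ⟨⟨u, w k :: p', w k :: p', a, b⟩, ⟨u, [w k], w k :: p', a, b⟩, ?_⟩
  exact
    { link := by simp [hpath]
      host_max := hp
      adj := by simpa using hadj
      full_start := rfl
      full_isStep := ⟨by simp, by simpa using hadj, hp, ⟨[], p', by simp⟩⟩
      full_host := .inl rfl
      full_subset := by simp
      full_length := by simp
      full_extension := .common l r x u v κ₁ κ₂ k w α hhost hpath h₁ h₂ rfl hfan hend rfl
      full_edges := fun y z _ h => by
        rcases h with h | h <;> simpa using h.length_le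
      single_or := .inl (by simp) }

/-- The colours `τ` and `α k` both differ from `κ₁` and `κ₂`: the repeated colour is not free at
`u`, while `κ₁` is, and representatives avoid `κ₂`. So the path found after the shift is a maximal
path of `c`, and it shares no edge with the previous path, whose edges have colours `κ₁` and `κ₂`.
-/
theorem exists_isContinuation_again [LinearOrder K] [Fintype V] [Fintype K] [DecidableRel G.Adj]
    (hdeg : G.maxDegree < Fintype.card K) (hc : IsProperPartial G c)
    (hQ : IsMaxPath c κ₁ κ₂ s.host)
    (hhost : s.host = l ++ x :: u :: v :: r) (hpath : s.path = l ++ [x, u])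
    (h₁ : c x u = some κ₁) (h₂ : c u v = some κ₂)
    (hfan : IsFan (shiftAlong c s.path u v κ₁ κ₂) u v κ₂ k w α)
    (hend : EndsRepeat (shiftAlong c s.path u v κ₁ κ₂) u k w α) :
    ∃ q f, IsContinuation G c s q f := by
  have huv := hc.adj _ _ _ h₂
  obtain ⟨hκ₁, hκ₂⟩ := avail_shiftAlong_centre hc (hhost ▸ hQ.nodup) h₁ h₂
  rw [← hpath] at hκ₁ hκ₂
  -- The blank edge leaves a second free colour at `u` besides `κ₁`; it is not `κ₂`, which is
  -- present at `u` after the shift. So `τ` exists.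
  obtain ⟨κ, hκ, hκne⟩ := exists_mem_avail_ne hdeg (fun _ _ _ => adj_of_shiftAlong hc) huv
    (shiftAlong_blank (c := c) (P := s.path) (κ₁ := κ₁) (κ₂ := κ₂)) κ₁
  obtain ⟨τ, hτ⟩ : ∃ τ, IsLeast (avail (shiftAlong c s.path u v κ₁ κ₂) u \ {κ₁, κ₂}) τ :=
    exists_isLeast ⟨κ, hκ, by
      rintro (h | h)
      · exact hκne h
      · exact hκ₂ (h ▸ hκ)⟩
  obtain ⟨hdisj, h, ⟨⟨hhk, hαav⟩, -⟩, hαk⟩ := id hend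
  have hτu := hτ.1.1
  have hτ1 : τ ≠ κ₁ := fun h => hτ.1.2 (by simp [h])
  have hτ2 : τ ≠ κ₂ := fun h => hτ.1.2 (by simp [h])
  have hαu : α h ∉ avail (shiftAlong c s.path u v κ₁ κ₂) u := fun hm =>
    (Set.mem_empty_iff_false (α h)).1 (hfan.disj h hhk ▸ ⟨(hfan.least h hhk).1.1, hm⟩)
  have hα1 : α h ≠ κ₁ := fun he => hαu (he ▸ hκ₁)
  have hα2 : α h ≠ κ₂ := fun he => (hfan.least h hhk).1.2 he
  have hτα : τ ≠ α k := fun he => hαu (hαk ▸ he ▸ hτu)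
  have iffτ := fun y z => shiftAlong_eq_some_iff (P := s.path) (y := y) (z := z) hc h₂ hτ1 hτ2
  have iffα := fun y z => shiftAlong_eq_some_iff (P := s.path) (y := y) (z := z) hc h₂ hα1 hα2
  have hαc : α k ∈ avail c (w k) := fun z hz => by
    rw [hαk] at hz
    exact hαav z ((iffα _ _).2 hz)
  obtain ⟨p, hp, hhead⟩ := exists_isMaxPath hc hτα hαc
  have hp' : IsMaxPath (shiftAlong c s.path u v κ₁ κ₂) τ (α k) p := hp.congr fun y _ z => by
    rw [HasColour, HasColour, hαk, iffτ, iffα]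
  have hadj := hfan.adj hc h₂ le_rfl
  have hedge : ∀ y z, IsPathEdge s.path y z → ¬ IsPathEdge p y z := by
    intro y z hyz hyz'
    have e1 : HasColour c κ₁ κ₂ y z :=
      hQ.hasColour hc (hyz.mono ⟨[], v :: r, by simp [hpath, hhost]⟩)
    have e2 := hp.hasColour hc hyz'
    rw [HasColour, hαk] at e2
    rcases e1 with e1 | e1 <;> rcases e2 with e2 | e2 <;> rw [e1] at e2 <;>
      simp only [Option.some.injEq] at e2
    exacts [hτ1 e2.symm, hα1 e2.symm, hτ2 e2.symm, hα2 e2.symm]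
  have hlink : s.path.getLast? = some u := by simp [hpath]
  have hadj' : ∀ y ∈ p.head?, G.Adj u y := by simpa [hhead] using hadj
  have htp : ∀ t, p.take t <+: p := fun t => List.take_prefix t p
  have ext : ∀ full (t : Step V K), t.start = u → t.col₁ = τ → t.col₂ = α k →
      Follows u k w p t.path full → IsExtension c s t full := fun full t e1 e2 e3 hF =>
    .again l r x u v κ₁ κ₂ k w α p full hhost hpath h₁ h₂ e1 hfan hend (e2 ▸ hτ) e3
      (by rw [e2, e3]; exact hp') hhead hF
  by_cases hlast : p.getLast? = some u
  · obtain ⟨p', rfl⟩ : ∃ p', p = p' ++ [u] := by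
      rcases p.eq_nil_or_concat' with rfl | ⟨p', y, rfl⟩
      · simp at hlast
      · exact ⟨p', by simpa using hlast⟩
    rcases p'.eq_nil_or_concat' with rfl | ⟨q', z, rfl⟩
    · simp only [List.nil_append, List.head?_cons, Option.some.injEq] at hhead
      exact absurd hhead hadj.ne
    have hpe : IsPathEdge (q' ++ [z] ++ [u]) u z := .inr ⟨q', [], by simp⟩
    -- `τ` is free at `u`, so the last edge has the repeated colour and comes from the fan vertex
    -- that follows `w h`.
    have hz : shiftAlong c s.path u v κ₁ κ₂ u z = some (α h) := by
      rcases hp.hasColour hc hpe with e | e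
      · exact absurd ((iffτ _ _).2 e) (hτu z)
      · exact (iffα _ _).2 (hαk ▸ e)
    obtain rfl : z = w (h + 1) :=
      hc.proper _ _ _ _ ((iffα _ _).1 hz) ((iffα _ _).1 (hfan.next h hhk))
    -- The colour `α h` occurs at `w (h + 1)` and is free at `w k`, so these vertices differ.
    have hlt : h + 1 < k := by
      refine lt_of_le_of_ne hhk fun he => ?_
      rw [he] at hz
      refine hαav u ((iffα _ _).2 ?_)
      rw [hc.symm]
      exact (iffα _ _).1 hz
    refine ⟨⟨u, q' ++ [w (h + 1)] ++ [u], q' ++ [w (h + 1)] ++ [u], τ, α k⟩,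
      ⟨u, (q' ++ [w (h + 1)]).reverse, (q' ++ [w (h + 1)] ++ [u]).reverse, τ, α k⟩, ?_⟩
    have hinf : q' ++ [w (h + 1)] <:+: q' ++ [w (h + 1)] ++ [u] := ⟨[], [u], by simp⟩
    exact
      { link := hlink
        host_max := hp
        adj := hadj'
        full_start := rfl
        full_isStep := ⟨by simp, by simpa using hfan.adj hc h₂ hlt.le, hp.reverse hc,
          List.reverse_infix.2 hinf⟩
        full_host := .inr rfl
        full_subset := by simp
        full_length := by simp
        full_extension := ext true _ rfl rfl rfl (.fullCentre q' (h + 1) hlt (by simp) rfl)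
        full_edges := fun y z hyz hyz' =>
          hedge y z hyz ((isPathEdge_reverse.1 hyz').mono hinf)
        single_or := .inr ⟨fun t ht ht' => ext false _ rfl rfl rfl
          (.truncCentre q' (h + 1) hlt (by simp) (htp t) (by
            simp [Step.trunc] at ht' ⊢; omega)), hedge⟩ }
  by_cases hfanlast : ∃ i < k, p.getLast? = some (w i)
  · obtain ⟨i, hi, hpi⟩ := hfanlast
    refine ⟨⟨u, p, p, τ, α k⟩, ⟨u, p.reverse, p.reverse, τ, α k⟩, ?_⟩
    exact
      { link := hlink
        host_max := hp
        adj := hadj'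
        full_start := rfl
        full_isStep := ⟨by simpa using hp.nonempty, by simpa [hpi] using hfan.adj hc h₂ hi.le,
          hp.reverse hc, List.infix_refl _⟩
        full_host := .inr rfl
        full_subset := by simp
        full_length := by simp
        full_extension := ext true _ rfl rfl rfl (.fullFan i hi hpi rfl)
        full_edges := fun y z hyz hyz' => hedge y z hyz (isPathEdge_reverse.1 hyz')
        single_or := .inr ⟨fun t ht ht' => ext false _ rfl rfl rfl
          (.truncFan i hi hpi (htp t) (by simp [Step.trunc] at ht' ⊢; omega)), hedge⟩ }
  · push Not at hfanlast
    refine ⟨⟨u, p, p, τ, α k⟩, ⟨u, p, p, τ, α k⟩, ?_⟩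
    exact
      { link := hlink
        host_max := hp
        adj := hadj'
        full_start := rfl
        full_isStep := ⟨hp.nonempty, hadj', hp, List.infix_refl _⟩
        full_host := .inl rfl
        full_subset := by simp
        full_length := by simp
        full_extension := ext true _ rfl rfl rfl (.fullAway hlast hfanlast rfl)
        full_edges := hedge
        single_or := .inr ⟨fun t ht ht' => ext false _ rfl rfl rfl
          (.truncAway hlast hfanlast (htp t) (by simp [Step.trunc] at ht' ⊢; omega)), hedge⟩ }

/-- The point is that `w k` is off the host. Only `κ₂` is free at `w k`, whereas two colours are
free at `v`, and `κ₂` is present at all other vertices of the host except possibly its ends, which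
are not adjacent to `u` by `hends`. So the component of `w k` is disjoint from the host, and the
shift leaves it unchanged. -/
theorem exists_isContinuation_second [LinearOrder K] [Fintype V] [Fintype K] [DecidableRel G.Adj]
    (hdeg : G.maxDegree < Fintype.card K) (hc : IsProperPartial G c)
    (hQ : IsMaxPath c κ₁ κ₂ s.host)
    (hhost : s.host = l ++ x :: u :: v :: r) (hpath : s.path = l ++ [x, u])
    (h₁ : c x u = some κ₁) (h₂ : c u v = some κ₂)
    (hends : ∀ y, G.Adj u y → s.host.head? ≠ some y ∧ s.host.getLast? ≠ some y)
    (hfan : IsFan (shiftAlong c s.path u v κ₁ κ₂) u v κ₂ k w α)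
    (hend : EndsSecond (shiftAlong c s.path u v κ₁ κ₂) u κ₂ k w α) :
    ∃ q f, IsContinuation G c s q f := by
  have huv := hc.adj _ _ _ h₂
  have hadj := hfan.adj hc h₂ le_rfl
  have hav : avail (shiftAlong c s.path u v κ₁ κ₂) (w k) = {κ₂} := hend.2.2.1
  have hκ₂ : κ₂ ∈ avail (shiftAlong c s.path u v κ₁ κ₂) (w k) := by simp [hav]
  have hwv : w k ≠ v := by
    intro he
    obtain ⟨κ, hκ, hne⟩ := exists_mem_avail_ne hdeg (fun _ _ _ => adj_of_shiftAlong hc) huv.symm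
      (shiftAlong_blank' (c := c) (P := s.path) (κ₁ := κ₁) (κ₂ := κ₂)) κ₂
    rw [he] at hav
    exact hne (hav.subset hκ)
  have hsub : ∀ y ∈ s.path, y ∈ s.host := by
    intro y
    simp only [hpath, hhost, List.mem_append, List.mem_cons]
    tauto
  have hmem : w k ∉ s.host := by
    intro hm
    have := notMem_avail_shiftAlong hc (hhost ▸ hQ) (hhost ▸ hm) hadj.ne' hwv
      (hhost ▸ (hends _ hadj).1) (hhost ▸ (hends _ hadj).2)
    rw [← hpath] at this
    exact this hκ₂
  have hu : u ∈ s.host := by simp [hhost]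
  have hv : v ∈ s.host := by simp [hhost]
  have hshift : ∀ y, y ∉ s.host → ∀ z, shiftAlong c s.path u v κ₁ κ₂ y z = c y z := fun y hy z =>
    shiftAlong_of_notMem (by rintro rfl; exact hy hu) (by rintro rfl; exact hy hv)
      (fun h => hy (hsub y h)) z
  have hκc : κ₂ ∈ avail c (w k) := fun z hz => hκ₂ z (by rwa [hshift _ hmem])
  obtain ⟨p, hp, hhead⟩ := exists_isMaxPath hc hQ.ne hκc
  have hdis : ∀ y ∈ p, y ∉ s.host := fun y hy hy' =>
    hmem (forall_mem_of_closed hc hQ.closed hp.coloured hy hy' _ (List.mem_of_mem_head? hhead))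
  have hp' : IsMaxPath (shiftAlong c s.path u v κ₁ κ₂) κ₁ κ₂ p := hp.congr fun y hy z => by
    rw [HasColour, HasColour, hshift y (hdis y hy)]
  have hadj' : ∀ y ∈ p.head?, G.Adj u y := by simpa [hhead] using hadj
  have hedge : ∀ y z, IsPathEdge s.path y z → ¬ IsPathEdge p y z := fun y z h h' =>
    hdis y h'.mem_left (hsub y h.mem_left)
  refine ⟨⟨u, p, p, κ₁, κ₂⟩, ⟨u, p, p, κ₁, κ₂⟩, ?_⟩
  exact
    { link := by simp [hpath]
      host_max := hp
      adj := hadj'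
      full_start := rfl
      full_isStep := ⟨hp.nonempty, hadj', hp, List.infix_refl _⟩
      full_host := .inl rfl
      full_subset := by simp
      full_length := by simp
      full_extension := .second l r x u v κ₁ κ₂ k w α p true hhost hpath h₁ h₂ rfl hfan hend rfl
        rfl hp' hhead (List.prefix_refl _) (by simp)
      full_edges := hedge
      single_or := .inr ⟨fun t ht ht' => .second l r x u v κ₁ κ₂ k w α p false hhost hpath h₁ h₂
        rfl hfan hend rfl rfl hp' hhead (List.take_prefix t p) (by
          simp only [Step.trunc, Bool.false_eq_true, false_iff]
          intro he
          have := congrArg List.length he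
          simp at this ht'
          omega), hedge⟩ }

theorem exists_split_of_lt_length {t : ℕ} (ht : 2 ≤ t) {Q : List V} (hQ : t < Q.length) :
    ∃ l r x u v, Q = l ++ x :: u :: v :: r ∧ Q.take t = l ++ [x, u] := by
  obtain ⟨n, rfl⟩ := Nat.exists_eq_add_of_le' ht
  have h : Q = Q.take n ++ Q[n] :: Q[n + 1] :: Q[n + 2] :: Q.drop (n + 3) := by
    conv_lhs => rw [← List.take_append_drop n Q]
    rw [List.drop_eq_getElem_cons (by omega), List.drop_eq_getElem_cons (by omega),
      List.drop_eq_getElem_cons (by omega)]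
  refine ⟨_, _, _, _, _, h, ?_⟩
  have h' : Q = (Q.take n ++ [Q[n], Q[n + 1]]) ++ Q[n + 2] :: Q.drop (n + 3) := by simp
  conv_lhs => rw [h']
  exact List.take_left' (by simp; omega)

/-- Each truncated step has a continuation, unless it ends next to an end of its host. -/
theorem exists_isContinuation [LinearOrder K] [Fintype V] [Fintype K] [DecidableRel G.Adj]
    (hdeg : G.maxDegree < Fintype.card K) (hc : IsProperPartial G c) {q : Step V K} {t : ℕ}
    (hq : IsMaxPath c q.col₁ q.col₂ q.host) (ht : 2 ≤ t) (htq : t < q.host.length)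
    (hends : ∀ u ∈ (q.trunc t).path.getLast?, ∀ y, G.Adj u y →
      q.host.head? ≠ some y ∧ q.host.getLast? ≠ some y) :
    ∃ q' f, IsContinuation G c (q.trunc t) q' f := by
  obtain ⟨l, r, x, u, v, hhost, hpath⟩ := exists_split_of_lt_length ht htq
  have e1 : HasColour c q.col₁ q.col₂ x u := hq.coloured _ _ ⟨l, v :: r, by simp [hhost]⟩
  have e2 : HasColour c q.col₁ q.col₂ u v := hq.coloured _ _ ⟨l ++ [x], r, by simp [hhost]⟩
  have hxv : x ≠ v := by
    have := hq.nodup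
    rintro rfl
    simp [hhost, List.nodup_append] at this
  have hsu : (q.trunc t).path.getLast? = some u := by simp [Step.trunc, hpath]
  obtain ⟨κ₁, κ₂, h₁, h₂, hQ⟩ : ∃ κ₁ κ₂, c x u = some κ₁ ∧ c u v = some κ₂ ∧
      IsMaxPath c κ₁ κ₂ q.host := by
    rcases e1 with e1 | e1 <;> rcases e2 with e2 | e2
    · exact absurd (hc.proper _ _ _ _ (hc.symm x u ▸ e1) e2) hxv
    · exact ⟨_, _, e1, e2, hq⟩
    · exact ⟨_, _, e1, e2, hq.swap⟩
    · exact absurd (hc.proper _ _ _ _ (hc.symm x u ▸ e1) e2) hxv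
  obtain ⟨k, w, α, hfan, hend | hend | hend⟩ :=
    exists_isFan (c := shiftAlong c (q.trunc t).path u v κ₁ κ₂) u v κ₂
      (avail_nonempty hdeg fun _ _ _ => adj_of_shiftAlong hc)
  · exact exists_isContinuation_common hdeg hc hhost hpath h₁ h₂ hfan hend
  · exact exists_isContinuation_again hdeg hc hQ hhost hpath h₁ h₂ hfan hend
  · exact exists_isContinuation_second hdeg hc hQ hhost hpath h₁ h₂ (hends u hsu) hfan hend

end Stepping

/-! ### Appending a step to a process -/

namespace Stepping

variable {V K : Type*}

section Lists

variable {σ : Type*} {R : σ → σ → Prop} {C : List σ} {x y : σ}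

theorem forall_lt_concat (h : ∀ (j k : ℕ) (_ : j < k) (hk : k < C.length), R C[j] C[k])
    (hy : ∀ x ∈ C, R x y) (j k : ℕ) (hjk : j < k) (hk : k < (C ++ [y]).length) :
    R (C ++ [y])[j] (C ++ [y])[k] := by
  by_cases hk' : k < C.length
  · rw [List.getElem_append_left hk', List.getElem_append_left (hjk.trans hk')]
    exact h j k hjk hk'
  · obtain rfl : k = C.length := by simp at hk; omega
    rw [List.getElem_append_left hjk]
    simpa using hy _ (List.getElem_mem _)

theorem forall_succ_lt_concat
    (h : ∀ (j k : ℕ) (_ : j + 1 < k) (hk : k < (C ++ [x]).length), R (C ++ [x])[j] (C ++ [x])[k])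
    (hy : ∀ x ∈ C, R x y) (j k : ℕ) (hjk : j + 1 < k) (hk : k < (C ++ [x] ++ [y]).length) :
    R (C ++ [x] ++ [y])[j] (C ++ [x] ++ [y])[k] := by
  by_cases hk' : k < (C ++ [x]).length
  · rw [List.getElem_append_left hk', List.getElem_append_left (by omega)]
    exact h j k hjk hk'
  · obtain rfl : k = (C ++ [x]).length := by simp at hk hk' ⊢; omega
    have hj : j < C.length := by simp at hjk; omega
    rw [List.getElem_append_left (by omega), List.getElem_append_left hj]
    simpa using hy _ (List.getElem_mem _)

theorem forall_consecutive_concat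
    (h : ∀ (j : ℕ) (hj : j + 1 < (C ++ [x]).length), R (C ++ [x])[j] (C ++ [x])[j + 1])
    (hxy : R x y) (j : ℕ) (hj : j + 1 < (C ++ [x] ++ [y]).length) :
    R (C ++ [x] ++ [y])[j] (C ++ [x] ++ [y])[j + 1] := by
  by_cases hj' : j + 1 < (C ++ [x]).length
  · rw [List.getElem_append_left hj', List.getElem_append_left (by omega)]
    exact h j hj'
  · obtain rfl : j = C.length := by simp at hj hj'; omega
    simpa using hxy

end Lists

section Append

variable {G : SimpleGraph V} {c : V → V → Option K} {w : V} {C : List (Step V K)} {s t : Step V K}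

theorem mem_hop2_self (x : V) : x ∈ hop2 G x := by simp [hop2]

theorem isSemiConsistent_singleton [LinearOrder K] (ht : IsStep G c t) :
    IsSemiConsistent G c t.start [t] where
  process := ⟨by simp, by simpa using ht, by simp, by simp⟩
  nonOverlapping :=
    ⟨fun j k _ hk => by simp at hk; omega, fun j k _ hk => by simp at hk; omega,
      fun j k _ hk => by simp at hk; omega, fun j k _ hk => by simp at hk; omega⟩
  extension j h := by simp at h
  centre_centre j k _ hk := by simp at hk; omega
  centre_path j k _ hk := by simp at hk; omega
  path_centre j k _ hk := by simp at hk; omega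
  path_path j k _ hk := by simp at hk; omega

/-- A vertex lies in its own `2`-hop neighbourhood, so disjointness from the steps in `C` follows
from the distance conditions; only the edges shared with the last step `s` need a separate
hypothesis. -/
theorem IsSemiConsistent.append [LinearOrder K] (h : IsSemiConsistent G c w (C ++ [s]))
    (ht : IsStep G c t) (hlink : s.path.getLast? = some t.start)
    (hext : ∃ full, IsExtension c s t full)
    (hedge : ∀ x z, IsPathEdge s.path x z → ¬ IsPathEdge t.path x z)
    (hhost : ∀ q ∈ C ++ [s], q.host ≠ t.host ∧ q.host ≠ t.host.reverse)
    (hcc : ∀ q ∈ C ++ [s], t.start ∉ hop2 G q.start)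
    (hcp : ∀ q ∈ C, ∀ x ∈ q.path, t.start ∉ hop2 G x)
    (hpc : ∀ q ∈ C ++ [s], ∀ z ∈ t.path, z ∉ hop2 G q.start)
    (hpp : ∀ q ∈ C, ∀ x ∈ q.path, ∀ z ∈ t.path, z ∉ hop2 G x) :
    IsSemiConsistent G c w (C ++ [s] ++ [t]) where
  process :=
    { ne := by simp
      steps := fun q hq => by
        rcases List.mem_append.1 hq with hq | hq
        · exact h.process.steps q hq
        · obtain rfl : q = t := by simpa using hq
          exact ht
      start := fun q hq => h.process.start q (by
        cases C <;> simpa using hq)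
      link := forall_consecutive_concat (R := fun p q : Step V K => p.path.getLast? = some q.start)
        h.process.link hlink }
  nonOverlapping :=
    { vertices := fun j k hjk hk hx => by
        by_contra hlt
        push Not at hlt
        exact forall_succ_lt_concat (R := fun p q : Step V K => ¬ ∃ x, x ∈ p.path ∧ x ∈ q.path)
          (fun j k hjk hk hx => by
            have := h.nonOverlapping.vertices j k (by omega) hk hx
            omega)
          (fun q hq ⟨x, hx, hx'⟩ => hpp q hq x hx x hx' (mem_hop2_self x)) j k hlt hk hx
      edges := forall_lt_concat
        (R := fun p q : Step V K => ∀ x z, ¬ (IsPathEdge p.path x z ∧ IsPathEdge q.path x z))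
        h.nonOverlapping.edges fun q hq x z ⟨h₁, h₂⟩ => by
          rcases List.mem_append.1 hq with hq | hq
          · exact hpp q hq x h₁.mem_left x h₂.mem_left (mem_hop2_self x)
          · obtain rfl : q = s := by simpa using hq
            exact hedge x z h₁ h₂
      centres := forall_lt_concat (R := fun p q : Step V K => ∀ x ∈ q.path, x ∉ hop2 G p.start)
        h.nonOverlapping.centres hpc
      hosts := forall_lt_concat (R := fun p q : Step V K => p.host ≠ q.host ∧ p.host ≠ q.host.reverse)
        h.nonOverlapping.hosts hhost }
  extension := forall_consecutive_concat (R := fun p q : Step V K => ∃ full, IsExtension c p q full)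
    h.extension hext
  centre_centre j k hkj hj := forall_lt_concat (R := fun p q : Step V K => q.start ∉ hop2 G p.start)
    (fun k j hkj hj => h.centre_centre j k hkj hj) hcc k j hkj hj
  centre_path j k hkj hj := forall_succ_lt_concat
    (R := fun p q : Step V K => ∀ x ∈ p.path, q.start ∉ hop2 G x)
    (fun k j hkj hj => h.centre_path j k hkj hj) hcp k j hkj hj
  path_centre j k hkj hj := forall_lt_concat (R := fun p q : Step V K => ∀ z ∈ q.path, z ∉ hop2 G p.start)
    (fun k j hkj hj => h.path_centre j k hkj hj) hpc k j hkj hj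
  path_path j k hkj hj := forall_succ_lt_concat
    (R := fun p q : Step V K => ∀ x ∈ p.path, ∀ z ∈ q.path, z ∉ hop2 G x)
    (fun k j hkj hj => h.path_path j k hkj hj) hpp k j hkj hj

theorem IsRestricted.append {i ℓ : ℝ} {a b : K} {P : List V} {y : V}
    (h : IsRestricted i ℓ (fun _ => ∅) (fun _ => ∅) a b P y (C ++ [s]))
    (ht : (t.path.length : ℝ) ≤ ℓ) (hlen : ((C.length + 2 : ℕ) : ℝ) ≤ i) :
    IsRestricted i ℓ (fun _ => ∅) (fun _ => ∅) a b P y (C ++ [s] ++ [t]) := by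
  have hhead : (C ++ [s] ++ [t]).head? = (C ++ [s]).head? := by cases C <;> simp
  exact
    { step_length := fun q hq => by
        rcases List.mem_append.1 hq with hq | hq
        · exact h.step_length q hq
        · obtain rfl : q = t := by simpa using hq
          exact ht
      steps := by simpa using hlen
      avoid_path := by simp
      avoid_centre := by simp
      first_host := hhead ▸ h.first_host
      first_path := hhead ▸ h.first_path
      first_vertex := hhead ▸ h.first_vertex }

end Append

/-! ### The truncation game and its trie -/

section Winning

/-- From the steps `E`, listed backwards, one reaches `good` processes by at most `m` further steps,
with at least `a` choices for each step but the last one. -/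
def Wins (good : List (Step V K) → Prop) (a : ℝ) : ℕ → List (Step V K) → Prop
  | 0, _ => False
  | m + 1, E => (∃ f, good (f :: E).reverse) ∨
      ∃ F : Finset (Step V K), a ≤ F.card ∧ Set.InjOn Step.path (F : Set (Step V K)) ∧
        ∀ s ∈ F, Wins good a m (s :: E)

/-- A winning strategy is the trie itself: a final step gives a leaf, a set `F` of choices gives a
node with `F.card` children. Injectivity of `Step.path` on `F` makes different choices different
characters, so the subtrie below a character comes from a single choice. -/
theorem Wins.exists_good {good : List (Step V K) → Prop} {a : ℝ} (ha : 0 < a) {m : ℕ}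
    {E : List (Step V K)} (h : Wins good a m E) :
    ∃ S : Set (List (Step V K)), S.Nonempty ∧ (∀ C ∈ S, good (E.reverse ++ C)) ∧
      ∀ p, (∃ t ∈ str '' S, p <+: t) → IsLeafNode (str '' S) p ∨
        ∃ F : Finset (List V), a ≤ F.card ∧ ∀ x ∈ F, ∃ t ∈ str '' S, p ++ [x] <+: t := by
  classical
  induction m generalizing E with
  | zero => exact h.elim
  | succ m ih =>
    rcases h with ⟨f, hf⟩ | ⟨F, haF, hinj, hF⟩
    · refine ⟨{[f]}, by simp, by simpa using hf, fun p hp => .inl ⟨[f.path], ?_, by simp⟩⟩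
      obtain ⟨t, ht, hpt⟩ := hp
      have e : str '' ({[f]} : Set (List (Step V K))) = {[f.path]} := by simp [str]
      rw [e] at ht ⊢
      obtain rfl : t = [f.path] := ht
      ext t
      constructor
      · exact fun h => h.1
      · rintro rfl
        exact ⟨rfl, hpt⟩
    · have ih' : ∀ s, s ∈ F → _ := fun s hs => ih (hF s hs)
      choose! S hS hgood htree using ih'
      have hmem : ∀ t, t ∈ str '' {C | ∃ s ∈ F, ∃ C' ∈ S s, C = s :: C'} ↔
          ∃ s ∈ F, ∃ t' ∈ str '' S s, t = s.path :: t' := by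
        intro t
        constructor
        · rintro ⟨_, ⟨s, hs, C', hC', rfl⟩, rfl⟩
          exact ⟨s, hs, str C', ⟨C', hC', rfl⟩, by simp [str]⟩
        · rintro ⟨s, hs, _, ⟨C', hC', rfl⟩, rfl⟩
          exact ⟨s :: C', ⟨s, hs, C', hC', rfl⟩, by simp [str]⟩
      refine ⟨{C | ∃ s ∈ F, ∃ C' ∈ S s, C = s :: C'}, ?_, ?_, ?_⟩
      · have : 0 < F.card := by exact_mod_cast ha.trans_le haF
        obtain ⟨s, hs⟩ := Finset.card_pos.1 this
        obtain ⟨C, hC⟩ := hS s hs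
        exact ⟨s :: C, s, hs, C, hC, rfl⟩
      · rintro _ ⟨s, hs, C', hC', rfl⟩
        simpa using hgood s hs C' hC'
      · rintro p ⟨t, ht, hpt⟩
        obtain ⟨s, hs, t', ht', rfl⟩ := (hmem t).1 ht
        rcases p with _ | ⟨x, p⟩
        · refine .inr ⟨F.image Step.path, ?_, ?_⟩
          · rwa [Finset.card_image_of_injOn hinj]
          · intro x hx
            obtain ⟨s', hs', rfl⟩ := Finset.mem_image.1 hx
            obtain ⟨C, hC⟩ := hS s' hs'
            exact ⟨s'.path :: str C, (hmem _).2 ⟨s', hs', _, ⟨C, hC, rfl⟩, rfl⟩, by simp⟩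
        · rw [List.cons_prefix_cons] at hpt
          obtain ⟨rfl, hpt⟩ := hpt
          rcases htree s hs p ⟨t', ht', hpt⟩ with ⟨t₀, h₀, hlen⟩ | ⟨F', haF', hF'⟩
          · refine .inl ⟨s.path :: t₀, ?_, by simpa using hlen⟩
            ext t
            constructor
            · rintro ⟨ht, hp⟩
              obtain ⟨s', hs', t'', ht'', rfl⟩ := (hmem t).1 ht
              rw [List.cons_prefix_cons] at hp
              obtain rfl := hinj hs hs' hp.1
              have : t'' ∈ ({t₀} : Set _) := h₀ ▸ ⟨ht'', hp.2⟩
              rw [Set.mem_singleton_iff.1 this]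
              rfl
            · rintro rfl
              have : t₀ ∈ {t | t ∈ str '' S s ∧ p <+: t} := h₀ ▸ rfl
              exact ⟨(hmem _).2 ⟨s, hs, t₀, this.1, rfl⟩, by simpa using this.2⟩
          · refine .inr ⟨F', haF', fun x hx => ?_⟩
            obtain ⟨t, ht, hp⟩ := hF' x hx
            exact ⟨s.path :: t, (hmem _).2 ⟨s, hs, t, ht, rfl⟩, by simpa using hp⟩

end Winning

end Stepping

/-! ### Exceptional centres and pending steps -/

namespace Stepping

variable {V K : Type*}

open Classical in
/-- The vertices next to the first vertex of a maximal bichromatic path through `e`. -/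
noncomputable def origins [Fintype V] (G : SimpleGraph V) (c : V → V → Option K) (e : V) :
    Finset V :=
  {w | ∃ a b p, IsMaxPath c a b p ∧ e ∈ p ∧ ∃ y, p.head? = some y ∧ G.Adj w y}

/-- For each pair of colours all maximal paths through `e` begin at one of the two ends of a single
path (`IsMaxPath.head_eq_end`), and each end has at most `G.maxDegree` neighbours. -/
theorem card_origins_le [Fintype V] [Fintype K] {G : SimpleGraph V} [DecidableRel G.Adj]
    {c : V → V → Option K} (hc : IsProperPartial G c) (e : V) :
    (origins G c e).card ≤ Fintype.card K * Fintype.card K * (2 * G.maxDegree) := by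
  classical
  let N : K × K → Finset V := fun ab =>
    {w | ∃ p, IsMaxPath c ab.1 ab.2 p ∧ e ∈ p ∧ ∃ y, p.head? = some y ∧ G.Adj w y}
  have hsub : origins G c e ⊆ Finset.univ.biUnion N := by
    intro w hw
    simp only [origins, Finset.mem_filter, Finset.mem_univ, true_and] at hw
    obtain ⟨a, b, p, hp, he, hy⟩ := hw
    exact Finset.mem_biUnion.2 ⟨(a, b), Finset.mem_univ _, by
      simpa [N] using ⟨p, hp, he, hy⟩⟩
  have hN : ∀ ab ∈ (Finset.univ : Finset (K × K)), (N ab).card ≤ 2 * G.maxDegree := by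
    intro ab _
    by_cases hex : ∃ p, IsMaxPath c ab.1 ab.2 p ∧ e ∈ p
    · obtain ⟨p, hp, hep⟩ := hex
      obtain ⟨y₁, h₁⟩ := Option.isSome_iff_exists.1 (List.isSome_head?.2 hp.nonempty)
      obtain ⟨y₂, h₂⟩ := (⟨_, List.getLast?_eq_some_getLast hp.nonempty⟩ : ∃ y, p.getLast? = some y)
      have : N ab ⊆ G.neighborFinset y₁ ∪ G.neighborFinset y₂ := by
        intro w hw
        obtain ⟨q, hq, heq, y, hy, hwy⟩ := (Finset.mem_filter.1 hw).2
        have := hp.head_eq_end hc hq hep heq hy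
        rw [h₁, h₂, Option.some.injEq, Option.some.injEq] at this
        rcases this with rfl | rfl <;> simp [hwy.symm]
      refine (Finset.card_le_card this).trans ((Finset.card_union_le _ _).trans ?_)
      rw [G.card_neighborFinset_eq_degree, G.card_neighborFinset_eq_degree]
      have := G.degree_le_maxDegree y₁
      have := G.degree_le_maxDegree y₂
      omega
    · have : N ab = ∅ := Finset.filter_eq_empty_iff.2 fun w _ ⟨q, hq, heq, _⟩ => hex ⟨q, hq, heq⟩
      simp [this]
  refine (Finset.card_le_card hsub).trans ((Finset.card_biUnion_le_card_mul _ _ _ hN).trans ?_)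
  simp

open Classical in
/-- The vertices at distance at most two from `B`. -/
noncomputable def near [Fintype V] (G : SimpleGraph V) (B : List V) : Finset V :=
  {z | ∃ b ∈ B, z ∈ hop2 G b}

theorem mem_near [Fintype V] {G : SimpleGraph V} {B : List V} {z : V} :
    z ∈ near G B ↔ ∃ b ∈ B, z ∈ hop2 G b := by simp [near]

theorem card_near_le [Fintype V] {G : SimpleGraph V} [DecidableRel G.Adj] (B : List V) :
    (near G B).card ≤ B.length * (G.maxDegree + 1) ^ 2 := by
  classical
  let nb : V → Finset V := fun x => insert x (G.neighborFinset x)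
  have hnb : ∀ x, (nb x).card ≤ G.maxDegree + 1 := fun x =>
    (Finset.card_insert_le _ _).trans (by simpa using G.degree_le_maxDegree x)
  have hsub : near G B ⊆ B.toFinset.biUnion fun b => (nb b).biUnion nb := by
    intro z hz
    obtain ⟨b, hb, hzb⟩ := mem_near.1 hz
    refine Finset.mem_biUnion.2 ⟨b, by simpa using hb, ?_⟩
    have hle : G.edist b z ≤ 2 := hzb
    obtain ⟨p, hp⟩ := SimpleGraph.exists_walk_of_edist_ne_top
      (ne_top_of_le_ne_top (by decide) hle)
    rw [← hp] at hle
    have hle' : p.length ≤ 2 := by exact_mod_cast hle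
    rcases p with _ | ⟨h, _ | ⟨h', _ | ⟨h'', p⟩⟩⟩
    · exact Finset.mem_biUnion.2 ⟨z, by simp [nb], by simp [nb]⟩
    · exact Finset.mem_biUnion.2 ⟨b, by simp [nb], by simp [nb, h]⟩
    · exact Finset.mem_biUnion.2 ⟨_, by simp only [nb, Finset.mem_insert,
        SimpleGraph.mem_neighborFinset]; exact .inr h, by simp [nb, h']⟩
    · simp at hle'
  refine (Finset.card_le_card hsub).trans <| (Finset.card_biUnion_le_card_mul _ _
    ((G.maxDegree + 1) ^ 2) fun b _ => ?_).trans ?_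
  · refine (Finset.card_biUnion_le_card_mul _ _ _ fun x _ => hnb x).trans ?_
    rw [sq]
    exact Nat.mul_le_mul_right _ (hnb b)
  · exact Nat.mul_le_mul_right _ (List.toFinset_card_le B)

open Classical in
/-- The vertices from which one reaches a vertex close to `B`, directly or along a path. -/
noncomputable def spread [Fintype V] (G : SimpleGraph V) (c : V → V → Option K) (B : List V) :
    Finset V := near G B ∪ (near G B).biUnion (origins G c)

theorem card_spread_le [Fintype V] {G : SimpleGraph V} [DecidableRel G.Adj]
    {c : V → V → Option K} {M : ℕ} (hM : ∀ e, (origins G c e).card ≤ M) (B : List V) :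
    (spread G c B).card ≤ (M + 1) * (B.length * (G.maxDegree + 1) ^ 2) := by
  classical
  refine (Finset.card_union_le _ _).trans ?_
  have h₁ : ((near G B).biUnion (origins G c)).card ≤ _ :=
    Finset.card_biUnion_le_card_mul _ _ M fun e _ => hM e
  calc _ ≤ (near G B).card + (near G B).card * M := by gcongr
    _ = (M + 1) * (near G B).card := by ring
    _ ≤ _ := by gcongr; exact card_near_le B

theorem spread_mono [Fintype V] {G : SimpleGraph V} {c : V → V → Option K} {B B' : List V}
    (h : B ⊆ B') : spread G c B ⊆ spread G c B' := by
  classical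
  have : near G B ⊆ near G B' := fun z hz => by
    obtain ⟨b, hb, hzb⟩ := mem_near.1 hz
    exact mem_near.2 ⟨b, h hb, hzb⟩
  exact Finset.union_subset_union this (Finset.biUnion_subset_biUnion_of_subset_left _ this)

/-- If the host met the neighbourhood of `B` in `z`, then `q.start`, being next to the first vertex
of the host, would be an origin of `z`. The whole host is kept away, and thus all its truncations.
-/
theorem notMem_of_notMem_spread [Fintype V] {G : SimpleGraph V} {c : V → V → Option K}
    {B : List V} {q : Step V K} (h : q.start ∉ spread G c B)
    (hq : IsMaxPath c q.col₁ q.col₂ q.host) (hadj : ∀ y ∈ q.host.head?, G.Adj q.start y) :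
    ∀ b ∈ B, q.start ∉ hop2 G b ∧ ∀ z ∈ q.host, z ∉ hop2 G b := by
  classical
  intro b hb
  refine ⟨fun hm => h (Finset.mem_union_left _ (mem_near.2 ⟨b, hb, hm⟩)), fun z hz hm => ?_⟩
  refine h (Finset.mem_union_right _ (Finset.mem_biUnion.2 ⟨z, mem_near.2 ⟨b, hb, hm⟩, ?_⟩))
  obtain ⟨y, hy⟩ := Option.isSome_iff_exists.1 (List.isSome_head?.2 hq.nonempty)
  simpa [origins] using ⟨_, _, _, hq, hz, y, hy, hadj y hy⟩

open Classical in
/-- The vertices next to an end of the host of one of the steps. -/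
noncomputable def endNeighbours [Fintype V] (G : SimpleGraph V) (E : List (Step V K)) :
    Finset V :=
  {u | ∃ q ∈ E, ∃ y, G.Adj u y ∧ (q.host.head? = some y ∨ q.host.getLast? = some y)}

theorem mem_endNeighbours [Fintype V] {G : SimpleGraph V} {E : List (Step V K)} {u : V} :
    u ∈ endNeighbours G E ↔
      ∃ q ∈ E, ∃ y, G.Adj u y ∧ (q.host.head? = some y ∨ q.host.getLast? = some y) := by
  simp [endNeighbours]

theorem card_endNeighbours_le [Fintype V] {G : SimpleGraph V} [DecidableRel G.Adj]
    (E : List (Step V K)) : (endNeighbours G E).card ≤ E.length * (2 * G.maxDegree) := by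
  classical
  let L : List V := E.flatMap fun q => q.host.head?.toList ++ q.host.getLast?.toList
  have hL : L.length ≤ E.length * 2 := by
    simp only [L, List.length_flatMap]
    refine (List.sum_le_card_nsmul _ 2 fun n hn => ?_).trans (by simp)
    obtain ⟨q, -, rfl⟩ := List.mem_map.1 hn
    rw [List.length_append]
    have : ∀ o : Option V, o.toList.length ≤ 1 := fun o => by cases o <;> simp
    have := this q.host.head?
    have := ‹∀ o : Option V, o.toList.length ≤ 1› q.host.getLast?
    omega
  have hsub : endNeighbours G E ⊆ L.toFinset.biUnion fun y => G.neighborFinset y := by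
    intro u hu
    obtain ⟨q, hq, y, huy, hy⟩ := mem_endNeighbours.1 hu
    refine Finset.mem_biUnion.2 ⟨y, ?_, by simpa using huy.symm⟩
    simp only [L, List.mem_toFinset, List.mem_flatMap]
    exact ⟨q, hq, by simpa using hy⟩
  calc _ ≤ _ := Finset.card_le_card hsub
    _ ≤ L.toFinset.card * G.maxDegree := Finset.card_biUnion_le_card_mul _ _ _ fun y _ => by
        simpa using G.degree_le_maxDegree y
    _ ≤ E.length * 2 * G.maxDegree := by
        gcongr
        exact (List.toFinset_card_le L).trans hL
    _ = _ := by ring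

/-- The steps `E`, listed backwards, have been truncated, and the next step follows the host of
`q`, which is long; all its truncations to between `2` and `L - 2` vertices are allowed. -/
structure IsPending [LinearOrder K] (G : SimpleGraph V) (c : V → V → Option K) (w : V)
    (good : List (Step V K) → Prop) (L : ℕ) (E : List (Step V K)) (q : Step V K) : Prop where
  host_max : IsMaxPath c q.col₁ q.col₂ q.host
  long : L < q.host.length
  adj : ∀ y ∈ q.host.head?, G.Adj q.start y
  link : ∀ s ∈ E.head?, s.path.getLast? = some q.start
  start_mem : ∀ s ∈ q :: E, s.start ∈ w :: E.flatMap Step.path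
  length_path : ∀ s ∈ E, s.path.length ≤ L
  trunc : ∀ t, 2 ≤ t → t + 2 ≤ L →
    IsSemiConsistent G c w (q.trunc t :: E).reverse ∧ good (q.trunc t :: E).reverse

/-- Unless the new centre is one of a few exceptional vertices, a truncated step can be extended:
either the new path is short and gives an augmenting process, or it is long and can be truncated. -/
theorem IsPending.next [Fintype V] [LinearOrder K] {G : SimpleGraph V} {c : V → V → Option K}
    {w : V} {good : List (Step V K) → Prop} {L t : ℕ} {E : List (Step V K)} {q q' f : Step V K}
    (hq : IsPending G c w good L E q)
    (hgood : ∀ C, ∀ s s' : Step V K, good (C ++ [s]) → C.length = E.length →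
      s'.path.length ≤ L → good (C ++ [s] ++ [s']))
    (ht : 2 ≤ t) (htL : t + 2 ≤ L) (hcont : IsContinuation G c (q.trunc t) q' f)
    (hends : q'.start ∉ endNeighbours G (q :: E))
    (hspread : q'.start ∉ spread G c (w :: E.flatMap Step.path)) :
    (∃ C, C = (f :: q.trunc t :: E).reverse ∧ IsSemiConsistent G c w C ∧ IsAugmenting c C ∧
      good C) ∨ IsPending G c w good L (q.trunc t :: E) q' := by
  have havoid := notMem_of_notMem_spread hspread hcont.host_max hcont.adj
  obtain ⟨hsc, hg⟩ := hq.trunc t ht htL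
  have hpath_mem : ∀ s ∈ E, ∀ x ∈ s.path, x ∈ w :: E.flatMap Step.path := fun s hs x hx =>
    List.mem_cons_of_mem _ (List.mem_flatMap.2 ⟨s, hs, hx⟩)
  have hstart : ∀ s ∈ E.reverse ++ [q.trunc t], s.start ∈ w :: E.flatMap Step.path := by
    intro s hs
    rcases List.mem_append.1 hs with hs | hs
    · exact hq.start_mem s (List.mem_cons_of_mem _ (List.mem_reverse.1 hs))
    · obtain rfl : s = q.trunc t := by simpa using hs
      exact hq.start_mem q List.mem_cons_self
  have happend : ∀ s' : Step V K, IsStep G c s' → s'.start = q'.start →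
      (s'.host = q'.host ∨ s'.host = q'.host.reverse) → s'.path ⊆ q'.host →
      (∃ full, IsExtension c (q.trunc t) s' full) →
      (∀ x z, IsPathEdge (q.trunc t).path x z → ¬ IsPathEdge s'.path x z) →
      IsSemiConsistent G c w (E.reverse ++ [q.trunc t] ++ [s']) := by
    intro s' hs' hst hhost hsub hext hedge
    refine IsSemiConsistent.append (by simpa using hsc) hs' (hst ▸ hcont.link) hext hedge ?_ ?_ ?_
      ?_ ?_
    · obtain ⟨y, hy⟩ := Option.isSome_iff_exists.1 (List.isSome_head?.2 hcont.host_max.nonempty)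
      -- The first vertex of the new host is adjacent to the new centre; if an earlier host were the
      -- same path, in either direction, this vertex would be an end of it.
      have key : ∀ s ∈ q :: E, s.host ≠ q'.host ∧ s.host ≠ q'.host.reverse := by
        refine fun s hs => ⟨fun he => hends ?_, fun he => hends ?_⟩ <;>
          refine mem_endNeighbours.2 ⟨s, hs, y, hcont.adj y hy, ?_⟩
        · exact .inl (he ▸ hy)
        · exact .inr (by rw [he, List.getLast?_reverse, hy])
      have key' : ∀ s ∈ E.reverse ++ [q.trunc t],
          s.host ≠ q'.host ∧ s.host ≠ q'.host.reverse := by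
        intro s hs
        rcases List.mem_append.1 hs with hs | hs
        · exact key s (List.mem_cons_of_mem _ (List.mem_reverse.1 hs))
        · obtain rfl : s = q.trunc t := by simpa using hs
          exact key q List.mem_cons_self
      intro s hs
      rcases hhost with h | h
      · rw [h]; exact key' s hs
      · rw [h, List.reverse_reverse]; exact (key' s hs).symm
    · exact fun s hs => hst ▸ (havoid _ (hstart s hs)).1
    · exact fun s hs x hx => hst ▸ (havoid _ (hpath_mem s (List.mem_reverse.1 hs) x hx)).1
    · exact fun s hs z hz => (havoid _ (hstart s hs)).2 z (hsub hz)
    · exact fun s hs x hx z hz =>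
        (havoid _ (hpath_mem s (List.mem_reverse.1 hs) x hx)).2 z (hsub hz)
  have hg' : ∀ s' : Step V K, s'.path.length ≤ L → good (E.reverse ++ [q.trunc t] ++ [s']) :=
    fun s' hs' => hgood _ _ _ (by simpa using hg) (by simp) hs'
  have hrev : ∀ s', (s' :: q.trunc t :: E).reverse = E.reverse ++ [q.trunc t] ++ [s'] := by simp
  by_cases hshort : f.path.length ≤ L
  · refine .inl ⟨_, rfl, ?_, .inr ⟨E.reverse, q.trunc t, f, by simp, hcont.full_extension⟩, ?_⟩
    · rw [hrev]
      exact happend f hcont.full_isStep hcont.full_start hcont.full_host hcont.full_subset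
        ⟨true, hcont.full_extension⟩ hcont.full_edges
    · rw [hrev]
      exact hg' f hshort
  · right
    -- Here the full path has more than `L ≥ 4` vertices, so it is not a single vertex.
    obtain ⟨hext, hedge⟩ := hcont.single_or.resolve_left (by omega)
    have hlong : L < q'.host.length := (not_le.1 hshort).trans_le hcont.full_length
    exact
      { host_max := hcont.host_max
        long := hlong
        adj := hcont.adj
        link := by simpa using hcont.link
        start_mem := by
          intro s hs
          rcases List.mem_cons.1 hs with rfl | hs
          · simp only [List.flatMap_cons, List.mem_cons, List.mem_append]
            exact .inr (.inl (List.mem_of_getLast? hcont.link))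
          · have : s.start ∈ w :: E.flatMap Step.path := by
              refine hstart s ?_
              rcases List.mem_cons.1 hs with rfl | hs <;> simp [*]
            simp only [List.flatMap_cons, List.mem_cons, List.mem_append] at this ⊢
            tauto
        length_path := by
          intro s hs
          rcases List.mem_cons.1 hs with rfl | hs
          · simp [Step.trunc]; omega
          · exact hq.length_path s hs
        trunc := fun t' ht' htL' => by
          have hpre : q'.host.take t' <:+: q'.host := (List.take_prefix t' _).isInfix
          rw [hrev]
          refine ⟨happend _ ⟨?_, ?_, hcont.host_max, hpre⟩ rfl (.inl rfl) hpre.subset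
            ⟨false, hext t' (by omega) (by omega)⟩ fun x z h h' => hedge x z h (h'.mono hpre),
            hg' _ ?_⟩
          · simp [Step.trunc, hcont.host_max.nonempty]; omega
          · intro y hy
            refine hcont.adj y ?_
            have : (q'.host.take t').head? = some y := hy
            rw [List.head?_take, if_neg (by omega)] at this
            exact this
          · simp [Step.trunc]; omega }

end Stepping

/-! ### Counting in layered trees -/

/-- A layered tree, in which each node has many children and the nodes of a layer are determined
up to `M ^ k` choices by their vertex, has boundedly many layers. The children `ch E t` of `E` that
are missing are those with `t` in a small set depending on `E`, and those whose vertex `en E t` is in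
a set `Y E` that is controlled by the parent of `E`. -/
theorem pow_le_of_layers {β V : Type*} [Fintype V] {P : ℕ → β → Prop} {root : β} {ch : β → ℕ → β}
    {en : β → ℕ → V} {st : β → V} {org : V → Finset V} {Y Y' : β → Finset V} {T : Finset ℕ}
    {n M A S R B : ℕ} (hroot : P 0 root)
    (hinj : ∀ k E E' t t', P k E → P k E' → t ∈ T → t' ∈ T → ch E t = ch E' t' →
      E = E' ∧ t = t')
    (hen : ∀ k E t t', P k E → t ∈ T → t' ∈ T → en E t = en E t' → t = t')
    (hst : ∀ k E t, P k E → t ∈ T → P (k + 1) (ch E t) → st (ch E t) = en E t)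
    (horg : ∀ k E t, P k E → t ∈ T → st E ∈ org (en E t)) (hM : ∀ v, (org v).card ≤ M)
    (hY : ∀ k E t, P k E → t ∈ T → P (k + 1) (ch E t) → Y (ch E t) ⊆ Y' E)
    (hB : ∀ k E, k < n → P k E → (Y' E).card ≤ B) (hS : (Y root).card ≤ S)
    (hchild : ∀ k E, k < n → P k E → ∃ W : Finset ℕ, W.card ≤ A ∧
      ∀ t ∈ T, t ∉ W → en E t ∉ Y E → P (k + 1) (ch E t))
    (hT : R + A + S ≤ T.card) (hMB : M * B ≤ S * R) : R ^ n ≤ Fintype.card V * M ^ n := by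
  classical
  obtain ⟨U, hU0, hUs⟩ : ∃ U : ℕ → Finset β, U 0 = {root} ∧
      ∀ k, U (k + 1) = ((U k ×ˢ T).image fun x => ch x.1 x.2).filter (P (k + 1)) :=
    ⟨fun k => Nat.rec {root} (fun k U => ((U ×ˢ T).image fun x => ch x.1 x.2).filter (P (k + 1))) k,
      rfl, fun _ => rfl⟩
  have hmem : ∀ k E', E' ∈ U (k + 1) ↔ (∃ E ∈ U k, ∃ t ∈ T, ch E t = E') ∧ P (k + 1) E' := by
    intro k E'
    rw [hUs, Finset.mem_filter, Finset.mem_image]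
    refine and_congr_left fun _ => ⟨?_, ?_⟩
    · rintro ⟨⟨E, t⟩, h, rfl⟩
      exact ⟨E, (Finset.mem_product.1 h).1, t, (Finset.mem_product.1 h).2, rfl⟩
    · rintro ⟨E, hE, t, ht, rfl⟩
      exact ⟨(E, t), Finset.mem_product.2 ⟨hE, ht⟩, rfl⟩
  have hP : ∀ k E, E ∈ U k → P k E := by
    intro k E hE
    cases k with
    | zero =>
      rw [hU0, Finset.mem_singleton] at hE
      exact hE ▸ hroot
    | succ k => exact ((hmem k E).1 hE).2
  -- The pairs of a node of layer `k` and a choice that is forbidden because its vertex lies in `Y`.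
  let bad : ℕ → Finset (β × ℕ) := fun k => (U k ×ˢ T).filter fun x => en x.1 x.2 ∈ Y x.1
  have hlow : ∀ k < n, T.card * (U k).card ≤ (U (k + 1)).card + A * (U k).card + (bad k).card := by
    intro k hk
    have hW : ∀ E, ∃ W : Finset ℕ, E ∈ U k → W.card ≤ A ∧
        ∀ t ∈ T, t ∉ W → en E t ∉ Y E → P (k + 1) (ch E t) := fun E => by
      by_cases hE : E ∈ U k
      · obtain ⟨W, hW⟩ := hchild k E hk (hP k E hE)
        exact ⟨W, fun _ => hW⟩
      · exact ⟨∅, fun h => absurd h hE⟩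
    choose W hW using hW
    have hsub : U k ×ˢ T ⊆ ((U k ×ˢ T).filter fun x => P (k + 1) (ch x.1 x.2)) ∪
        ((U k).biUnion fun E => (W E).image fun t => (E, t)) ∪ bad k := by
      rintro ⟨E, t⟩ h
      obtain ⟨hE, ht⟩ := Finset.mem_product.1 h
      by_cases h₁ : t ∈ W E
      · exact Finset.mem_union_left _ (Finset.mem_union_right _ (Finset.mem_biUnion.2
          ⟨E, hE, Finset.mem_image.2 ⟨t, h₁, rfl⟩⟩))
      by_cases h₂ : en E t ∈ Y E
      · exact Finset.mem_union_right _ (Finset.mem_filter.2 ⟨h, h₂⟩)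
      · exact Finset.mem_union_left _ (Finset.mem_union_left _ (Finset.mem_filter.2
          ⟨h, (hW E hE).2 t ht h₁ h₂⟩))
    have h₁ : ((U k ×ˢ T).filter fun x => P (k + 1) (ch x.1 x.2)).card ≤ (U (k + 1)).card := by
      refine Finset.card_le_card_of_injOn (fun x => ch x.1 x.2) ?_ ?_
      · rintro ⟨E, t⟩ h
        obtain ⟨h, h'⟩ := Finset.mem_filter.1 h
        obtain ⟨hE, ht⟩ := Finset.mem_product.1 h
        exact (hmem k _).2 ⟨⟨E, hE, t, ht, rfl⟩, h'⟩
      · rintro ⟨E, t⟩ h ⟨E', t'⟩ h' he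
        obtain ⟨hE, ht⟩ := Finset.mem_product.1 (Finset.mem_filter.1 h).1
        obtain ⟨hE', ht'⟩ := Finset.mem_product.1 (Finset.mem_filter.1 h').1
        obtain ⟨rfl, rfl⟩ := hinj k E E' t t' (hP k E hE) (hP k E' hE') ht ht' he
        rfl
    have h₂ : ((U k).biUnion fun E => (W E).image fun t => (E, t)).card ≤ (U k).card * A :=
      Finset.card_biUnion_le_card_mul _ _ _ fun E hE =>
        Finset.card_image_le.trans (hW E hE).1
    have h₃ := (Finset.card_le_card hsub).trans ((Finset.card_union_le _ _).trans
      (Nat.add_le_add_right (Finset.card_union_le _ _) _))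
    rw [Finset.card_product] at h₃
    linarith [mul_comm (U k).card T.card, mul_comm (U k).card A]
  have hbad0 : (bad 0).card ≤ S := by
    refine (Finset.card_le_card_of_injOn (t := Y root) (fun x => en x.1 x.2) ?_ ?_).trans hS
    · rintro ⟨E, t⟩ h
      obtain ⟨h, h'⟩ := Finset.mem_filter.1 h
      have hE := (Finset.mem_product.1 h).1
      rw [hU0, Finset.mem_singleton] at hE
      obtain rfl : E = root := hE
      exact h'
    · rintro ⟨E, t⟩ h ⟨E', t'⟩ h' he
      obtain ⟨hE, ht⟩ := Finset.mem_product.1 (Finset.mem_filter.1 h).1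
      obtain ⟨hE', ht'⟩ := Finset.mem_product.1 (Finset.mem_filter.1 h').1
      rw [hU0, Finset.mem_singleton] at hE hE'
      obtain rfl : E = root := hE
      obtain rfl : E' = E := hE'
      rw [hen 0 _ t t' hroot ht ht' he]
  -- The averaging step. A bad pair at a child of `E` is determined by `E`, the vertex `y ∈ Y' E`
  -- that it hits and the centre `v ∈ org y` of the child: `v` fixes the child, then `y` fixes the
  -- choice.
  have hbad : ∀ k < n, (bad (k + 1)).card ≤ M * B * (U k).card := by
    intro k hk
    let piece : β → V → V → Finset (β × ℕ) := fun E y v => (U (k + 1) ×ˢ T).filter fun x =>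
      (∃ t ∈ T, x.1 = ch E t) ∧ st x.1 = v ∧ en x.1 x.2 = y
    have hpiece : ∀ E ∈ U k, ∀ y v, (piece E y v).card ≤ 1 := by
      intro E hE y v
      refine Finset.card_le_one.2 ?_
      rintro ⟨_, t₁⟩ h₁ ⟨_, t₂⟩ h₂
      obtain ⟨h₁, ⟨s₁, hs₁, rfl⟩, hv₁, hy₁⟩ := Finset.mem_filter.1 h₁
      obtain ⟨h₂, ⟨s₂, hs₂, e₂⟩, hv₂, hy₂⟩ := Finset.mem_filter.1 h₂
      obtain ⟨hE₁, ht₁⟩ := Finset.mem_product.1 h₁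
      obtain ⟨hE₂, ht₂⟩ := Finset.mem_product.1 h₂
      dsimp only at *
      subst e₂
      have hPE := hP k E hE
      rw [hst k E _ hPE hs₁ (hP _ _ hE₁)] at hv₁
      rw [hst k E _ hPE hs₂ (hP _ _ hE₂)] at hv₂
      obtain rfl := hen k E _ _ hPE hs₁ hs₂ (hv₁.trans hv₂.symm)
      obtain rfl := hen _ _ _ _ (hP _ _ hE₁) ht₁ ht₂ (hy₁.trans hy₂.symm)
      rfl
    have hsub : bad (k + 1) ⊆ (U k).biUnion fun E => (Y' E).biUnion fun y =>
        (org y).biUnion fun v => piece E y v := by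
      rintro ⟨E', t'⟩ h
      obtain ⟨h, hy⟩ := Finset.mem_filter.1 h
      obtain ⟨hE', ht'⟩ := Finset.mem_product.1 h
      obtain ⟨⟨E, hE, t, ht, rfl⟩, hP'⟩ := (hmem k E').1 hE'
      refine Finset.mem_biUnion.2 ⟨E, hE, Finset.mem_biUnion.2 ⟨_, hY k E t (hP k E hE) ht hP' hy,
        Finset.mem_biUnion.2 ⟨_, horg _ _ t' hP' ht', Finset.mem_filter.2
          ⟨h, ⟨t, ht, rfl⟩, rfl, rfl⟩⟩⟩⟩
    refine (Finset.card_le_card hsub).trans ?_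
    refine (Finset.card_biUnion_le_card_mul _ _ (B * (M * 1)) fun E hE => ?_).trans
      (le_of_eq (by ring))
    refine (Finset.card_biUnion_le_card_mul _ _ (M * 1) fun y _ => ?_).trans
      (Nat.mul_le_mul_right _ (hB k E hk (hP k E hE)))
    exact (Finset.card_biUnion_le_card_mul _ _ 1 fun v _ => hpiece E hE y v).trans
      (Nat.mul_le_mul_right _ (hM y))
  have hgrow : ∀ k < n, R * (U k).card ≤ (U (k + 1)).card := by
    intro k
    induction k with
    | zero =>
      intro hk
      have := hlow 0 hk
      rw [hU0, Finset.card_singleton] at this ⊢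
      omega
    | succ k ih =>
      intro hk
      have h₁ := hlow (k + 1) hk
      have h₂ := hbad k (by omega)
      have h₃ := ih (by omega)
      -- The previous layer is smaller by a factor `R`, so its `M * B` bad pairs per node become at
      -- most `S` per node of the present layer.
      have h₄ : M * B * (U k).card ≤ S * (U (k + 1)).card :=
        calc _ ≤ S * R * (U k).card := Nat.mul_le_mul_right _ hMB
          _ = S * (R * (U k).card) := by ring
          _ ≤ _ := Nat.mul_le_mul_left _ h₃
      have h₅ : (R + A + S) * (U (k + 1)).card ≤ T.card * (U (k + 1)).card :=
        Nat.mul_le_mul_right _ hT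
      nlinarith
  have hpow : ∀ k ≤ n, R ^ k ≤ (U k).card := by
    intro k
    induction k with
    | zero => simp [hU0]
    | succ k ih =>
      intro hk
      calc R ^ (k + 1) = R * R ^ k := by ring
        _ ≤ R * (U k).card := Nat.mul_le_mul_left _ (ih (by omega))
        _ ≤ _ := hgrow k hk
  -- Backwards, a centre has at most `M` possible predecessors `v'`; the node with centre `v'` and
  -- the vertex `v` determine the choice.
  have hfib : ∀ k v, ((U k).filter fun E => st E = v).card ≤ M ^ k := by
    intro k
    induction k with
    | zero => exact fun v => (Finset.card_filter_le _ _).trans (by simp [hU0])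
    | succ k ih =>
      intro v
      let piece : β → Finset β := fun E => (U (k + 1)).filter fun E' =>
        ∃ t ∈ T, E' = ch E t ∧ en E t = v
      have hpiece : ∀ E ∈ U k, (piece E).card ≤ 1 := by
        intro E hE
        refine Finset.card_le_one.2 fun E₁ h₁ E₂ h₂ => ?_
        obtain ⟨-, t₁, ht₁, rfl, e₁⟩ := Finset.mem_filter.1 h₁
        obtain ⟨-, t₂, ht₂, rfl, e₂⟩ := Finset.mem_filter.1 h₂
        rw [hen k E _ _ (hP k E hE) ht₁ ht₂ (e₁.trans e₂.symm)]
      have hsub : ((U (k + 1)).filter fun E => st E = v) ⊆ (org v).biUnion fun v' =>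
          ((U k).filter fun E => st E = v').biUnion piece := by
        intro E' h
        obtain ⟨hE', rfl⟩ := Finset.mem_filter.1 h
        obtain ⟨⟨E, hE, t, ht, rfl⟩, hP'⟩ := (hmem k E').1 hE'
        have e := hst k E t (hP k E hE) ht hP'
        refine Finset.mem_biUnion.2 ⟨st E, e ▸ horg k E t (hP k E hE) ht, Finset.mem_biUnion.2
          ⟨E, Finset.mem_filter.2 ⟨hE, rfl⟩, Finset.mem_filter.2 ⟨hE', t, ht, rfl, e.symm⟩⟩⟩
      refine (Finset.card_le_card hsub).trans ?_
      calc _ ≤ (org v).card * (M ^ k * 1) := Finset.card_biUnion_le_card_mul _ _ _ fun v' _ =>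
            (Finset.card_biUnion_le_card_mul _ _ 1 fun E hE =>
              hpiece E (Finset.mem_filter.1 hE).1).trans (Nat.mul_le_mul_right _ (ih v'))
        _ ≤ M * (M ^ k * 1) := Nat.mul_le_mul_right _ (hM v)
        _ = _ := by ring
  calc R ^ n ≤ (U n).card := hpow n le_rfl
    _ ≤ M ^ n * (Finset.univ : Finset V).card :=
        Finset.card_le_mul_card_image_of_maps_to (f := st) (fun _ _ => Finset.mem_univ _) _
          fun v _ => hfib n v
    _ = _ := by rw [Finset.card_univ, mul_comm]

/-! ### Heaviness for short and for long paths -/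

namespace Stepping

variable {V K : Type*}

theorem getLast?_take_of_le {Q : List V} {t : ℕ} (h₁ : 1 ≤ t) (h₂ : t ≤ Q.length) :
    (Q.take t).getLast? = Q[t - 1]? := by
  rw [List.getLast?_take, if_neg (by omega), List.getElem?_eq_getElem (by omega)]
  rfl

/-- The step that is to be truncated next, after the steps `E` (listed backwards). -/
def pendingStep (root : Step V K) (nxt : Step V K → Step V K) : List (Step V K) → Step V K
  | [] => root
  | s :: _ => nxt s

theorem length_flatMap_path_le {E : List (Step V K)} {L : ℕ} (h : ∀ s ∈ E, s.path.length ≤ L) :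
    (E.flatMap Step.path).length ≤ E.length * L := by
  rw [List.length_flatMap]
  refine (List.sum_le_card_nsmul _ L fun n hn => ?_).trans (by simp)
  obtain ⟨q, hq, rfl⟩ := List.mem_map.1 hn
  exact h q hq

theorem isRestricted_singleton {i ℓ : ℝ} {a b : K} {P : List V} {y w : V} {Q : List V}
    (hi : 1 ≤ i) (hQ : (Q.length : ℝ) ≤ ℓ) (hy : Q.head? = some y) (hQP : Q <+: P) :
    IsRestricted i ℓ (fun _ => ∅) (fun _ => ∅) a b P y [(⟨w, Q, P, a, b⟩ : Step V K)] where
  step_length := by simpa using hQ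
  steps := by simpa using hi
  avoid_path := by simp
  avoid_centre := by simp
  first_host := by simp
  first_path := by simpa using hQP
  first_vertex := by simpa using hy

theorem isHeavy_of_short [LinearOrder K] {G : SimpleGraph V} {c : V → V → Option K} {i ℓ a : ℝ}
    {κ₁ κ₂ : K} {P : List V} {y w : V} (hi : 1 ≤ i) (hP : IsMaxPath c κ₁ κ₂ P) (hy : P.head? = some y)
    (hwy : G.Adj w y) (hℓ : (P.length : ℝ) ≤ ℓ) :
    IsHeavy G c a i ℓ (fun _ => ∅) (fun _ => ∅) κ₁ κ₂ P y w := by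
  have hstep : IsStep G c (⟨w, P, P, κ₁, κ₂⟩ : Step V K) :=
    ⟨hP.nonempty, by simpa [hy] using hwy, hP, List.infix_refl _⟩
  refine ⟨{[⟨w, P, P, κ₁, κ₂⟩]}, by simp, ?_, ?_⟩
  · rintro _ rfl
    exact ⟨isSemiConsistent_singleton hstep, .inl ⟨_, rfl, rfl⟩,
      isRestricted_singleton hi hℓ hy (List.prefix_refl _)⟩
  · rintro p ⟨s, hs, hp⟩ -
    have e : str '' ({[⟨w, P, P, κ₁, κ₂⟩]} : Set (List (Step V K))) = {[P]} := by simp [str]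
    rw [e] at hs ⊢
    obtain rfl : s = [P] := hs
    refine .inl ⟨[P], ?_, by simp⟩
    ext t
    constructor
    · exact fun h => h.1
    · rintro rfl
      exact ⟨rfl, hp⟩

variable [Fintype V] [Fintype K] [LinearOrder K] {G : SimpleGraph V} [DecidableRel G.Adj]
  {c : V → V → Option K} {i ℓ a : ℝ} {κ₁ κ₂ : K} {P : List V} {y w : V}

/-- If the empty list loses, the losing lists with a long next path satisfy `pow_le_of_layers` with
`I - 1` layers, against `hbig`. `R` is the growth rate, and `S` bounds the average loss to `spread`;
in `hRL` the next terms are the winning truncations and the neighbours of ends of hosts, and `3` is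
there because `2, …, L - 2` are `L - 3` lengths. -/
theorem isHeavy_of_long {L I R S : ℕ} (hdeg : G.maxDegree < Fintype.card K)
    (hc : IsProperPartial G c) (hP : IsMaxPath c κ₁ κ₂ P) (hy : P.head? = some y)
    (hwy : G.Adj w y) (hL : (L : ℝ) ≤ ℓ) (hLP : L < P.length) (ha : 0 < a) (hI : 2 ≤ I)
    (hIi : (I : ℝ) ≤ i)
    (hS : (2 * Fintype.card K ^ 3 + 1) * Fintype.card K ^ 2 ≤ S)
    (hRS : 2 * Fintype.card K ^ 3 *
      ((2 * Fintype.card K ^ 3 + 1) * ((1 + I * L) * Fintype.card K ^ 2)) ≤ S * R)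
    (hRL : R + (⌈a⌉₊ + I * (2 * Fintype.card K)) + S + 3 ≤ L)
    (hbig : Fintype.card V * (2 * Fintype.card K ^ 3) ^ (I - 1) < R ^ (I - 1)) :
    IsHeavy G c a i ℓ (fun _ => ∅) (fun _ => ∅) κ₁ κ₂ P y w := by
  classical
  set D := Fintype.card K with hD
  let root : Step V K := ⟨w, P, P, κ₁, κ₂⟩
  let res : List (Step V K) → Prop :=
    IsRestricted i ℓ (fun _ => ∅) (fun _ => ∅) κ₁ κ₂ P y
  let good : List (Step V K) → Prop := fun C =>
    IsSemiConsistent G c w C ∧ IsAugmenting c C ∧ res C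
  have hnext : ∀ s : Step V K, ∃ p : Step V K × Step V K,
      (∃ q f, IsContinuation G c s q f) → IsContinuation G c s p.1 p.2 := fun s => by
    by_cases h : ∃ q f, IsContinuation G c s q f
    · obtain ⟨q, f, h⟩ := h
      exact ⟨(q, f), fun _ => h⟩
    · exact ⟨(root, root), fun h' => absurd h' h⟩
  choose nxt hnxt using hnext
  let cur : List (Step V K) → Step V K := pendingStep root fun s => (nxt s).1
  -- The vertex at which the truncation to `t` vertices stops; the default `w` is not met for `t` in
  -- the range used.
  let en : List (Step V K) → ℕ → V := fun E t => ((cur E).host[t - 1]?).getD w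
  let node : ℕ → List (Step V K) → Prop := fun k E =>
    E.length = k ∧ IsPending G c w res L E (cur E) ∧ ¬ Wins good a (I - k) E
  have hI1 : (1 : ℝ) ≤ i := le_trans (by exact_mod_cast (by omega : 1 ≤ I)) hIi
  have htake : ∀ {E t}, IsPending G c w res L E (cur E) → t ∈ Finset.Icc 2 (L - 2) →
      ((cur E).trunc t).path.getLast? = some (en E t) ∧ (cur E).host[t - 1]? = some (en E t) := by
    intro E t hE ht
    have hlong := hE.long
    rw [Finset.mem_Icc] at ht
    have : (cur E).host[t - 1]? = some (en E t) := by
      simp only [en]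
      rw [List.getElem?_eq_getElem (by omega)]
      rfl
    exact ⟨(getLast?_take_of_le (by omega) (by omega)).trans this, this⟩
  have hlen : ∀ {E t}, IsPending G c w res L E (cur E) → t ∈ Finset.Icc 2 (L - 2) →
      ((cur E).trunc t).path.length = t := by
    intro E t hE ht
    have hlong := hE.long
    rw [Finset.mem_Icc] at ht
    simp only [Step.trunc, List.length_take]
    omega
  have hen : ∀ k E t t', node k E → t ∈ Finset.Icc 2 (L - 2) → t' ∈ Finset.Icc 2 (L - 2) →
      en E t = en E t' → t = t' := by
    intro k E t t' hE ht ht' he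
    have h₁ := (htake hE.2.1 ht).2
    have h₂ := (htake hE.2.1 ht').2
    have hlong := hE.2.1.long
    rw [Finset.mem_Icc] at ht ht'
    have := (List.getElem?_inj (i := t - 1) (j := t' - 1) (by omega) hE.2.1.host_max.nodup).1
      (h₁.trans (he ▸ h₂.symm))
    omega
  have hM : ∀ e, (origins G c e).card ≤ 2 * D ^ 3 := fun e =>
    (card_origins_le hc e).trans <| calc
      D * D * (2 * G.maxDegree) ≤ D * D * (2 * D) := by gcongr
      _ = 2 * D ^ 3 := by ring
  have hspread : ∀ B, (spread G c B).card ≤ (2 * D ^ 3 + 1) * (B.length * D ^ 2) := fun B =>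
    (card_spread_le hM B).trans (by gcongr; omega)
  have hwin : Wins good a I [] := by
    by_contra hlose
    refine absurd (pow_le_of_layers (P := node) (root := []) (en := en)
      (ch := fun E t => (cur E).trunc t :: E) (st := fun E => (cur E).start)
      (org := origins G c) (Y := fun E => spread G c (w :: E.flatMap Step.path))
      -- Every truncation of the current host lies in its first `L` vertices, so this set does not
      -- depend on which one is chosen.
      (Y' := fun E => spread G c (w :: ((cur E).host.take L ++ E.flatMap Step.path)))
      (T := Finset.Icc 2 (L - 2)) (n := I - 1) (M := 2 * D ^ 3) (R := R) (S := S)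
      (A := ⌈a⌉₊ + I * (2 * D)) (B := (2 * D ^ 3 + 1) * ((1 + I * L) * D ^ 2))
      ?_ ?_ hen ?_ ?_ hM ?_ ?_ ?_ ?_ ?_ hRS) (not_le.2 hbig)
    · refine ⟨rfl, ?_, hlose⟩
      exact
        { host_max := hP
          long := hLP
          adj := by simpa [cur, pendingStep, root, hy] using hwy
          link := by simp
          start_mem := by simp [cur, pendingStep, root]
          length_path := by simp
          trunc := fun t ht htL => by
            have hpre : P.take t <+: P := List.take_prefix t P
            have hhead : (P.take t).head? = some y := by
              rw [List.head?_take, if_neg (by omega), hy]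
            have hne : P.take t ≠ [] := by
              intro h
              simp [h] at hhead
            refine ⟨isSemiConsistent_singleton (t := (⟨w, P.take t, P, κ₁, κ₂⟩ : Step V K))
              ⟨hne, by simpa [hhead] using hwy, hP, hpre.isInfix⟩,
              isRestricted_singleton hI1 (le_trans ?_ hL) hhead hpre⟩
            exact_mod_cast (List.length_take_le t P).trans (by omega) }
    · intro k E E' t t' hE hE' ht ht' he
      obtain ⟨h₁, rfl⟩ := List.cons.inj he
      refine ⟨rfl, ?_⟩
      rw [← hlen hE.2.1 ht, h₁, hlen hE.2.1 ht']
    · intro k E t hE ht hch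
      have h₁ := hch.2.1.link _ (List.head?_cons)
      rw [(htake hE.2.1 ht).1] at h₁
      exact (Option.some.inj h₁).symm
    · intro k E t hE ht
      obtain ⟨z, hz⟩ := Option.isSome_iff_exists.1 (List.isSome_head?.2 hE.2.1.host_max.nonempty)
      simpa [origins] using ⟨_, _, _, hE.2.1.host_max,
        List.mem_of_getElem? (htake hE.2.1 ht).2, z, hz, hE.2.1.adj z hz⟩
    · intro k E t hE ht _
      refine spread_mono ?_
      rw [Finset.mem_Icc] at ht
      have : (cur E).host.take t ⊆ (cur E).host.take L :=
        (List.take_prefix_take_left (by omega)).subset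
      intro z hz
      simp only [List.flatMap_cons, List.mem_cons, List.mem_append] at hz ⊢
      exact hz.imp_right fun hz => hz.imp_left fun hz => this hz
    · intro k E hk hE
      refine (hspread _).trans ?_
      gcongr
      have h₁ := length_flatMap_path_le hE.2.1.length_path
      have h₂ : (k + 1) * L ≤ I * L := Nat.mul_le_mul_right _ (by omega)
      rw [hE.1] at h₁
      simp only [List.length_cons, List.length_append, List.length_take]
      have h₃ : min L (cur E).host.length ≤ L := min_le_left _ _
      rw [Nat.add_mul, Nat.one_mul] at h₂
      omega
    · refine (hspread _).trans (le_trans ?_ hS)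
      simp
    · intro k E hk hE
      obtain ⟨m, hm⟩ : ∃ m, I - k = m + 2 := ⟨I - k - 2, by omega⟩
      have hm' : I - (k + 1) = m + 1 := by omega
      obtain ⟨hEk, hpend, hnw⟩ := hE
      rw [hm] at hnw
      let W₁ := (Finset.Icc 2 (L - 2)).filter fun t => Wins good a (m + 1) ((cur E).trunc t :: E)
      let W₂ := (Finset.Icc 2 (L - 2)).filter fun t => en E t ∈ endNeighbours G (cur E :: E)
      refine ⟨W₁ ∪ W₂, (Finset.card_union_le _ _).trans (add_le_add ?_ ?_), ?_⟩
      -- More than `⌈a⌉` winning truncations would make `E` itself winning.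
      · by_contra! hlt
        refine hnw (.inr ⟨W₁.image (cur E).trunc, ?_, ?_, ?_⟩)
        · rw [Finset.card_image_of_injOn]
          · exact (Nat.le_ceil a).trans (by exact_mod_cast hlt.le)
          · intro t ht t' ht' he
            rw [← hlen hpend (Finset.mem_filter.1 ht).1, he,
              hlen hpend (Finset.mem_filter.1 ht').1]
        · intro s hs s' hs' he
          obtain ⟨t, ht, rfl⟩ := Finset.mem_image.1 hs
          obtain ⟨t', ht', rfl⟩ := Finset.mem_image.1 hs'
          rw [← hlen hpend (Finset.mem_filter.1 ht).1, he,
            hlen hpend (Finset.mem_filter.1 ht').1]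
        · intro s hs
          obtain ⟨t, ht, rfl⟩ := Finset.mem_image.1 hs
          exact (Finset.mem_filter.1 ht).2
      · have h₁ : W₂.card ≤ (endNeighbours G (cur E :: E)).card := by
          refine Finset.card_le_card_of_injOn (en E) (fun t ht => (Finset.mem_filter.1 ht).2) ?_
          intro t ht t' ht' he
          exact hen k E t t' ⟨hEk, hpend, hm ▸ hnw⟩ (Finset.mem_filter.1 ht).1
            (Finset.mem_filter.1 ht').1 he
        refine h₁.trans ((card_endNeighbours_le _).trans ?_)
        rw [List.length_cons, hEk]
        exact Nat.mul_le_mul (by omega) (by omega)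
      · intro t ht htW htY
        have ht' := Finset.mem_Icc.1 ht
        have ht₁ : ¬ Wins good a (m + 1) ((cur E).trunc t :: E) := fun h =>
          htW (Finset.mem_union_left _ (Finset.mem_filter.2 ⟨ht, h⟩))
        have ht₂ : en E t ∉ endNeighbours G (cur E :: E) := fun h =>
          htW (Finset.mem_union_right _ (Finset.mem_filter.2 ⟨ht, h⟩))
        have hcont : IsContinuation G c ((cur E).trunc t) (nxt ((cur E).trunc t)).1
            (nxt ((cur E).trunc t)).2 := by
          refine hnxt _ (exists_isContinuation hdeg hc hpend.host_max ht'.1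
            (lt_of_le_of_lt (by omega) hpend.long) ?_)
          intro u hu z huz
          rw [(htake hpend ht).1, Option.mem_def, Option.some.injEq] at hu
          subst hu
          rw [mem_endNeighbours] at ht₂
          push Not at ht₂
          exact ht₂ _ List.mem_cons_self z huz
        have hlink := hcont.link
        rw [(htake hpend ht).1, Option.some.injEq] at hlink
        have happ : ∀ C, ∀ s s' : Step V K, res (C ++ [s]) → C.length = E.length →
            s'.path.length ≤ L → res (C ++ [s] ++ [s']) := by
          intro C s s' hC hCE hs'
          refine IsRestricted.append hC (le_trans (by exact_mod_cast hs') hL) (le_trans ?_ hIi)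
          exact_mod_cast (by omega : C.length + 2 ≤ I)
        -- An augmenting process is excluded since it would make the child winning; so the child is
        -- pending and losing.
        rcases hpend.next happ ht'.1 (by omega) hcont (hlink ▸ ht₂) (hlink ▸ htY) with
          ⟨C, rfl, h₁, h₂, h₃⟩ | h
        · exact absurd (.inl ⟨_, h₁, h₂, h₃⟩) ht₁
        · exact ⟨by simp [hEk], h, hm' ▸ ht₁⟩
    · rw [Nat.card_Icc]
      omega
  obtain ⟨S, hS, hgood, htree⟩ := hwin.exists_good ha
  exact ⟨S, hS, fun C hC => by simpa using hgood C hC, fun p hp _ => htree p hp⟩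

end Stepping

/-! ### Choice of the parameters -/

/-- The numerical estimates behind the choice of the parameters. -/
theorem Stepping.estimates {D N L : ℕ} {r ℓ a : ℝ} (hD : 2 ≤ D) (hN : 0 < N)
    (hr : r = √(Real.logb 2 N)) (hr1 : 1 ≤ r) (hL : L = ⌊ℓ⌋₊) (hLN : L < N)
    (hℓ : 10 ^ 4 * (10 * ((D : ℝ) - 1) + 1) ^ (50 * r) ≤ ℓ)
    (ha : a ≤ ℓ / ((2 : ℝ) ^ (3 * r) * (D : ℝ) ^ (6 * r))) :
    2 ≤ ⌊r⌋₊ ∧ 1 ≤ L / 2 ∧ L / 2 + (⌈a⌉₊ + ⌊r⌋₊ * (2 * D)) + 24 * D ^ 8 * ⌊r⌋₊ + 3 ≤ L ∧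
      N * (2 * D ^ 3) ^ (⌊r⌋₊ - 1) < (L / 2) ^ (⌊r⌋₊ - 1) := by
  have hD' : (2 : ℝ) ≤ D := by exact_mod_cast hD
  have hD0 : (0 : ℝ) ≤ D := by linarith
  have hr0 : 0 ≤ r := by linarith
  have hNr : (N : ℝ) = 2 ^ (r * r) := by
    have h1 : (1 : ℝ) ≤ N := by exact_mod_cast hN
    rw [hr, Real.mul_self_sqrt (Real.logb_nonneg (by norm_num) h1),
      Real.rpow_logb (by norm_num) (by norm_num) (by linarith)]
  set Z : ℝ := (D : ℝ) ^ r with hZ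
  have hZ2 : (2 : ℝ) ^ r ≤ Z := Real.rpow_le_rpow (by norm_num) hD' hr0
  have hZD : (D : ℝ) ≤ Z := by
    simpa using Real.rpow_le_rpow_of_exponent_le (by linarith : (1 : ℝ) ≤ D) hr1
  have hZr : r ≤ Z := by
    refine le_trans ?_ hZ2
    have := one_add_mul_self_le_rpow_one_add (s := 1) (by norm_num) hr1
    norm_num at this
    linarith
  have hZ1 : 2 ≤ Z := hD'.trans hZD
  have hℓZ : 10 ^ 4 * Z ^ 50 ≤ ℓ := by
    refine le_trans ?_ hℓ
    have : Z ^ 50 = (D : ℝ) ^ (50 * r) := by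
      rw [hZ, ← Real.rpow_natCast, ← Real.rpow_mul hD0]
      norm_num [mul_comm]
    rw [this]
    gcongr
    linarith
  have hZ9 : Z ^ 9 * 2 ^ 41 ≤ Z ^ 50 := by
    calc Z ^ 9 * 2 ^ 41 ≤ Z ^ 9 * Z ^ 41 := by gcongr
      _ = Z ^ 50 := by ring
  have hZ91 : 1 ≤ Z ^ 9 := one_le_pow₀ (by linarith)
  have hℓ9 : 10 ^ 4 * Z ^ 9 ≤ ℓ := by linarith
  have hL1 : ℓ - 1 < L := hL ▸ Nat.sub_one_lt_floor ℓ
  have hℓN : ℓ < N := by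
    rw [hL] at hLN
    exact (Nat.floor_lt (by linarith)).1 hLN
  -- A path with more than `ℓ` vertices forces `2 ^ (50 * r) < N = 2 ^ (r * r)`.
  have hr50 : 50 < r := by
    have h1 : (2 : ℝ) ^ (50 * r) < 2 ^ (r * r) := by
      rw [← hNr]
      refine lt_of_le_of_lt ?_ hℓN
      have : (2 : ℝ) ^ (50 * r) = ((2 : ℝ) ^ r) ^ 50 := by
        rw [← Real.rpow_natCast, ← Real.rpow_mul (by norm_num)]
        norm_num [mul_comm]
      rw [this]
      have h2 : ((2 : ℝ) ^ r) ^ 50 ≤ Z ^ 50 := by gcongr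
      linarith
    have h2 := (Real.rpow_lt_rpow_left_iff (by norm_num : (1 : ℝ) < 2)).1 h1
    exact lt_of_mul_lt_mul_right h2 hr0
  set I := ⌊r⌋₊ with hI
  have hI1 : r - 1 < I := Nat.sub_one_lt_floor r
  have hIr : (I : ℝ) ≤ r := Nat.floor_le hr0
  have hI2 : 2 ≤ I := Nat.le_floor (by norm_num; linarith)
  have hIZ : (I : ℝ) ≤ Z := hIr.trans hZr
  have hhalf : ℓ / 4 ≤ ((L / 2 : ℕ) : ℝ) := by
    have : (L : ℝ) ≤ 2 * ((L / 2 : ℕ) : ℝ) + 1 := by exact_mod_cast (by omega)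
    linarith
  have ha8 : a ≤ ℓ / 8 := by
    refine ha.trans ?_
    have h1 : (8 : ℝ) ≤ 2 ^ (3 * r) := by
      have := Real.rpow_le_rpow_of_exponent_le (by norm_num : (1 : ℝ) ≤ 2)
        (by linarith : (3 : ℝ) ≤ 3 * r)
      norm_num at this
      linarith
    have h2 : (1 : ℝ) ≤ (D : ℝ) ^ (6 * r) := Real.one_le_rpow (by linarith) (by linarith)
    have h3 : 0 ≤ ℓ := by linarith
    gcongr
    nlinarith
  refine ⟨hI2, ?_, ?_, ?_⟩
  · have : (1 : ℝ) ≤ ((L / 2 : ℕ) : ℝ) := by linarith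
    exact_mod_cast this
  · have hceil : (⌈a⌉₊ : ℝ) ≤ ℓ / 8 + 1 := by
      have h := Nat.ceil_mono ha8
      have h' := (Nat.ceil_lt_add_one (by linarith : 0 ≤ ℓ / 8)).le
      exact le_trans (by exact_mod_cast h) h'
    have h1 : (I : ℝ) * (2 * D) ≤ 2 * Z ^ 9 := by
      calc (I : ℝ) * (2 * D) ≤ Z * (2 * Z) := by gcongr
        _ = 2 * Z ^ 2 := by ring
        _ ≤ 2 * Z ^ 9 := by gcongr <;> linarith
    have h2 : 24 * (D : ℝ) ^ 8 * I ≤ 24 * Z ^ 9 := by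
      calc 24 * (D : ℝ) ^ 8 * I ≤ 24 * Z ^ 8 * Z := by gcongr
        _ = 24 * Z ^ 9 := by ring
    have h3 : ((L / 2 : ℕ) : ℝ) ≤ L / 2 := Nat.cast_div_le
    have : ((L / 2 : ℕ) : ℝ) + (⌈a⌉₊ + I * (2 * D)) + 24 * (D : ℝ) ^ 8 * I + 3 ≤ L := by linarith
    exact_mod_cast this
  -- The exponent `50` is split as `3 + 47`: three factors `Z` absorb `D ^ 3`, the others give `2 ^
  -- (47 * r)`, whose power `I - 1 > r - 2` exceeds `N = 2 ^ (r * r)`.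
  · have h1 : 2 * (D : ℝ) ^ 3 * 2 ^ (47 * r) ≤ ((L / 2 : ℕ) : ℝ) := by
      have e : (2 : ℝ) ^ (47 * r) = ((2 : ℝ) ^ r) ^ 47 := by
        rw [← Real.rpow_natCast, ← Real.rpow_mul (by norm_num)]
        norm_num [mul_comm]
      have : 2 * (D : ℝ) ^ 3 * 2 ^ (47 * r) ≤ 2 * Z ^ 3 * Z ^ 47 := by
        rw [e]; gcongr
      have e' : 2 * Z ^ 3 * Z ^ 47 = 2 * Z ^ 50 := by ring
      have : 0 ≤ Z ^ 50 := by positivity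
      linarith
    have h2 : (N : ℝ) < ((2 : ℝ) ^ (47 * r)) ^ (I - 1) := by
      rw [hNr, ← Real.rpow_natCast, ← Real.rpow_mul (by norm_num)]
      refine Real.rpow_lt_rpow_of_exponent_lt (by norm_num) ?_
      rw [Nat.cast_sub (by omega)]
      push_cast
      nlinarith
    have h3 : (N : ℝ) * (2 * (D : ℝ) ^ 3) ^ (I - 1) < ((L / 2 : ℕ) : ℝ) ^ (I - 1) := by
      refine lt_of_lt_of_le ?_ (pow_le_pow_left₀ (by positivity) h1 _)
      rw [mul_pow (2 * (D : ℝ) ^ 3), mul_comm (N : ℝ)]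
      exact mul_lt_mul_of_pos_left h2 (by positivity)
    exact_mod_cast h3

theorem theorem5 {V : Type*} [Fintype V] (G : SimpleGraph V) [DecidableRel G.Adj]
    (Δmax : ℕ) (hΔ : G.maxDegree ≤ Δmax)
    (c : V → V → Option (Fin (Δmax + 1))) (hc : Stepping.IsProperPartial G c)
    (ℓ a : ℝ)
    (hℓ : 10 ^ 4 * (10 * (Δmax : ℝ) + 1) ^ (50 * √(Real.logb 2 (Fintype.card V))) ≤ ℓ)
    (ha₁ : ℓ / ((2 : ℝ) ^ (3 * √(Real.logb 2 (Fintype.card V))) *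
      ((Δmax : ℝ) + 1) ^ (8 * √(Real.logb 2 (Fintype.card V)))) ≤ a)
    (ha₂ : a ≤ ℓ / ((2 : ℝ) ^ (3 * √(Real.logb 2 (Fintype.card V))) *
      ((Δmax : ℝ) + 1) ^ (6 * √(Real.logb 2 (Fintype.card V)))))
    (w y : V) (hwy : G.Adj w y)
    (κ₁ κ₂ : Fin (Δmax + 1)) (P : List V)
    (hP : Stepping.IsMaxPath c κ₁ κ₂ P) (hy : P.head? = some y) :
    Stepping.IsHeavy G c a √(Real.logb 2 (Fintype.card V)) ℓ
      (fun _ => ∅) (fun _ => ∅) κ₁ κ₂ P y w := by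
  classical
  have hN : 2 ≤ Fintype.card V := Fintype.one_lt_card_iff.2 ⟨w, y, hwy.ne⟩
  have hr1 : 1 ≤ √(Real.logb 2 (Fintype.card V)) := by
    rw [Real.one_le_sqrt, Real.le_logb_iff_rpow_le (by norm_num) (by positivity), Real.rpow_one]
    exact_mod_cast hN
  by_cases hshort : (P.length : ℝ) ≤ ℓ
  · exact Stepping.isHeavy_of_short hr1 hP hy hwy hshort
  have hΔ1 : 1 ≤ Δmax :=
    ((G.degree_pos_iff_exists_adj w).2 ⟨y, hwy⟩).trans_le ((G.degree_le_maxDegree w).trans hΔ)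
  have hℓ0 : 0 < ℓ := lt_of_lt_of_le (by positivity) hℓ
  have ha : 0 < a := lt_of_lt_of_le (by positivity) ha₁
  have hLP : ⌊ℓ⌋₊ < P.length := (Nat.floor_lt hℓ0.le).2 (not_le.1 hshort)
  obtain ⟨hI, hR, hRL, hbig⟩ := Stepping.estimates (D := Δmax + 1) (N := Fintype.card V) (a := a)
    (by omega) (by omega) rfl hr1 rfl (hLP.trans_le hP.nodup.length_le_card)
    (by push_cast; simpa using hℓ) (by push_cast; exact ha₂)
  have hD : 1 ≤ Δmax + 1 := by omega
  have hI1 : 1 ≤ ⌊√(Real.logb 2 (Fintype.card V))⌋₊ := by omega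
  -- `S` is what `M * B ≤ S * R` asks for when `2 * D ^ 3 + 1 ≤ 3 * D ^ 3` and `1 + I * L ≤ 4 * I *
  -- R`, since `2 * 3 * 4 = 24` and `3 + 3 + 2 = 8`.
  refine Stepping.isHeavy_of_long (L := ⌊ℓ⌋₊) (I := ⌊√(Real.logb 2 (Fintype.card V))⌋₊)
    (R := ⌊ℓ⌋₊ / 2) (S := 24 * (Δmax + 1) ^ 8 * ⌊√(Real.logb 2 (Fintype.card V))⌋₊)
    (by simpa using Nat.lt_succ_of_le hΔ) hc hP hy hwy (Nat.floor_le hℓ0.le) hLP ha hI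
    (Nat.floor_le (by positivity)) ?_ ?_ (by simpa using hRL) (by simpa using hbig)
  all_goals
    rw [Fintype.card_fin]
    generalize Δmax + 1 = D at *
    generalize ⌊√(Real.logb 2 (Fintype.card V))⌋₊ = I at *
    have hD3 : 2 * D ^ 3 + 1 ≤ 3 * D ^ 3 := by
      have := Nat.one_le_pow 3 D hD
      omega
  · calc (2 * D ^ 3 + 1) * D ^ 2 ≤ 3 * D ^ 3 * D ^ 2 * (D ^ 3 * I) :=
          (Nat.mul_le_mul_right _ hD3).trans
            (Nat.le_mul_of_pos_right _ (Nat.mul_pos (Nat.pow_pos hD) hI1))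
      _ = 3 * (D ^ 8 * I) := by ring
      _ ≤ 24 * (D ^ 8 * I) := Nat.mul_le_mul_right _ (by norm_num)
      _ = _ := by ring
  · generalize ⌊ℓ⌋₊ = L at *
    have h : 1 + I * L ≤ 4 * I * (L / 2) := by
      have hL : L ≤ 2 * (L / 2) + 1 := by omega
      calc 1 + I * L ≤ I + I * (2 * (L / 2) + 1) := by gcongr
        _ = I * (2 * (L / 2) + 2) := by ring
        _ ≤ I * (4 * (L / 2)) := Nat.mul_le_mul_left _ (by omega)
        _ = _ := by ring
    calc 2 * D ^ 3 * ((2 * D ^ 3 + 1) * ((1 + I * L) * D ^ 2))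
        ≤ 2 * D ^ 3 * (3 * D ^ 3 * (4 * I * (L / 2) * D ^ 2)) := by gcongr
      _ = _ := by ring
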